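/- Let $d\ge 1$ and let $Z(t)$, $t\in\mathbb R^d$, be a non-negative random field whose sample paths are almost surely (generalised, i.e. quadrant-wise) càdlàg, such that $E[Z(t)]=1$ for all $t\in\mathbb R^d$, $E[\sup_{t\in[0,T]^d}Z(t)]<\infty$ for all $T>0$, and $P(\sup_{t\in\mathbb R^d}Z(t)>0)=1$. Let $\Gamma_i=\mathcal V_1+\dots+\mathcal V_i$ with independent unit exponential random variables $\mathcal V_k$, let $Z^{(1)},Z^{(2)},\dots$ be independent copies of $Z$, independent of $(\mathcal V_k)_{k\ge1}$, and suppose that the max-stable random field $$X(t)=\max_{i\ge1}\Gamma_i^{-1}Z^{(i)}(t),\qquad t\in\mathbb R^d,$$ is stationary. Let $\Theta$ be a random field with càdlàg sample paths and law $\mu(A)=E[Z(0)\mathbf 1\{Z/Z(0)\in A\}]$, let $R$ be independent of $\Theta$ with $P(R>r)=1/r$ for $r\ge1$, and put $Y(t)=R\,\Theta(t)$. For $\delta>0$ let $\lambda_\delta$ be $\delta^d$ times the counting measure on $\delta\mathbb Z^d$; for $\delta=0$ put $0\mathbb Z^d=\mathbb R^d$ and let $\lambda_0$ be Lebesgue measure.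 Define $$\epsilon_\delta(Y)=\int_{\delta\mathbb Z^d}\mathbf 1\{Y(t)>1\}\,\lambda_\delta(dt)\in[0,\infty]$$ and the Berman function $$\mathcal B_Z^\delta(x)=\lim_{T\to\infty}\frac1{T^d}\int_0^\infty P\Big(\int_{[0,T]^d\cap\delta\mathbb Z^d}\mathbf 1\{Z(t)>s\}\,\lambda_\delta(dt)>x\Big)\,ds .$$ Then for all $\delta\ge0$ and $x>0$ the limit defining $\mathcal B_Z^\delta(x)$ exists, and $$\frac{P(\epsilon_\delta(Y)>x)^2}{E[\epsilon_\delta(Y)]}\le \mathcal B_Z^\delta(x)\le x^{-1}P(\epsilon_\delta(Y)\ge x),$$ where the left-hand side is read as $0$ if $E[\epsilon_\delta(Y)]=\infty$. -/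

import Mathlib

open MeasureTheory ProbabilityTheory Filter Topology
open scoped ENNReal NNReal

noncomputable section

/-- Generalised càdlàg functions `ℝ^d → [0, ∞)`: at every point `t` the function has a finite limit
along each of the `2^d` quadrants `{s | s_i ≥ t_i for i ∈ E, s_i < t_i for i ∉ E}`. The quadrant with
`E` everything contains `t`, so that the limit along it is the value at `t` ("right-continuity"). -/
def IsCadlag {d : ℕ} (f : (Fin d → ℝ) → ℝ≥0) : Prop :=
  ∀ (t : Fin d → ℝ) (E : Set (Fin d)), ∃ l : ℝ≥0,
    Tendsto f (𝓝[{s | ∀ i, (i ∈ E → t i ≤ s i) ∧ (i ∉ E → s i < t i)}] t) (𝓝 l)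

/-- The measure `λ_δ`: Lebesgue measure on `ℝ^d` for `δ = 0`, and `δ^d` times the counting measure
on the lattice `δ ℤ^d` (regarded as a measure on `ℝ^d`) otherwise. -/
def gridMeasure (d : ℕ) (δ : ℝ) : Measure (Fin d → ℝ) :=
  if δ = 0 then volume
  else ENNReal.ofReal (δ ^ d) •
    Measure.sum (fun k : Fin d → ℤ => Measure.dirac (fun i => δ * (k i : ℝ)))

/-- The sojourn `∫_{A ∩ δℤ^d} 1{f(t) > s} λ_δ(dt)`; recall that `λ_δ` is carried by `δℤ^d`. -/
def sojourn {d : ℕ} (δ : ℝ) (A : Set (Fin d → ℝ)) (f : (Fin d → ℝ) → ℝ) (s : ℝ) : ℝ≥0∞ :=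
  gridMeasure d δ (A ∩ {t | s < f t})

/-- The cube `[0,T]^d`. -/
def cube (d : ℕ) (T : ℝ) : Set (Fin d → ℝ) := Set.Icc 0 (fun _ => T)

/-- A random field with nonnegative values, unit mean, almost surely càdlàg sample paths, integrable
suprema over cubes, and which almost surely is not identically zero. -/
structure IsSpectralField {Ω : Type*} [MeasurableSpace Ω] (P : Measure Ω) {d : ℕ}
    (Z : Ω → (Fin d → ℝ) → ℝ≥0) : Prop where
  measurable : ∀ t, Measurable (fun ω => Z ω t)
  cadlag : ∀ᵐ ω ∂P, IsCadlag (Z ω)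
  mean_one : ∀ t, ∫⁻ ω, (Z ω t : ℝ≥0∞) ∂P = 1
  sup_integrable : ∀ T : ℝ, 0 < T → ∫⁻ ω, (⨆ t ∈ cube d T, (Z ω t : ℝ≥0∞)) ∂P < ∞
  sup_pos : ∀ᵐ ω ∂P, 0 < ⨆ t, (Z ω t : ℝ≥0∞)

/-- The ingredients of the de Haan representation with spectral field `Z`: independent unit
exponential variables `V 0, V 1, …`, and, independent of them, independent copies
`W 0, W 1, …` of `Z`. -/
structure IsDeHaanSample {Ω Ω₁ : Type*} [MeasurableSpace Ω] [MeasurableSpace Ω₁]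
    (P : Measure Ω) {d : ℕ} (Z : Ω → (Fin d → ℝ) → ℝ≥0) (P₁ : Measure Ω₁)
    (V : ℕ → Ω₁ → ℝ) (W : ℕ → Ω₁ → (Fin d → ℝ) → ℝ≥0) : Prop where
  measurable_V : ∀ k, Measurable (V k)
  law_V : ∀ k, P₁.map (V k) = expMeasure 1
  indep_V : iIndepFun V P₁
  measurable_W : ∀ i, Measurable (W i)
  law_W : ∀ i, P₁.map (W i) = P.map Z
  indep_W : iIndepFun W P₁
  indep_VW : IndepFun (fun ω k => V k ω) (fun ω i => W i ω) P₁

/-- The max-stable field `X(t) = max_{i ≥ 1} Γ_i⁻¹ Z^{(i)}(t)`, where `Γ_i = V_1 + ⋯ + V_i`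
(the indices start from `0` here). -/
def deHaanField {Ω₁ : Type*} {d : ℕ} (V : ℕ → Ω₁ → ℝ) (W : ℕ → Ω₁ → (Fin d → ℝ) → ℝ≥0)
    (t : Fin d → ℝ) (ω : Ω₁) : ℝ≥0∞ :=
  ⨆ i : ℕ, (W i ω t : ℝ≥0∞) / ENNReal.ofReal (∑ k ∈ Finset.range (i + 1), V k ω)

/-- Stationarity: the finite-dimensional distributions are invariant under all shifts. -/
def IsStationaryField {Ω₁ : Type*} [MeasurableSpace Ω₁] (P₁ : Measure Ω₁) {d : ℕ}
    (X : (Fin d → ℝ) → Ω₁ → ℝ≥0∞) : Prop :=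
  ∀ (n : ℕ) (t : Fin n → Fin d → ℝ) (h : Fin d → ℝ),
    IdentDistrib (fun ω j => X (t j + h) ω) (fun ω j => X (t j) ω) P₁ P₁

/-- The law `μ(A) = E[Z(0) 1{Z / Z(0) ∈ A}]` on paths, for the σ-field generated by the projections. -/
def tiltedLaw {Ω : Type*} [MeasurableSpace Ω] (P : Measure Ω) {d : ℕ}
    (Z : Ω → (Fin d → ℝ) → ℝ≥0) : Measure ((Fin d → ℝ) → ℝ≥0) :=
  (P.withDensity (fun ω => (Z ω 0 : ℝ≥0∞))).map (fun ω t => Z ω t / Z ω 0)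

/-- `R` is a 1-Pareto variable (survival function `1/r` for `r ≥ 1`), independent of the field `Θ`,
which has law `μ` and almost surely càdlàg sample paths. -/
structure IsParetoTilted {Ω Ω₂ : Type*} [MeasurableSpace Ω] [MeasurableSpace Ω₂]
    (P : Measure Ω) {d : ℕ} (Z : Ω → (Fin d → ℝ) → ℝ≥0) (P₂ : Measure Ω₂)
    (R : Ω₂ → ℝ) (Θ : Ω₂ → (Fin d → ℝ) → ℝ≥0) : Prop where
  measurable_R : Measurable R
  survival_R : ∀ r : ℝ, 1 ≤ r → P₂ {ω | r < R ω} = ENNReal.ofReal (1 / r)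
  measurable_Θ : Measurable Θ
  cadlag_Θ : ∀ᵐ ω ∂P₂, IsCadlag (Θ ω)
  law_Θ : P₂.map Θ = tiltedLaw P Z
  indep : IndepFun R Θ P₂

/-- `ε_δ(Y) = ∫_{δℤ^d} 1{Y(t) > 1} λ_δ(dt)` for `Y(t) = R Θ(t)`. -/
def sojournY {Ω₂ : Type*} {d : ℕ} (δ : ℝ) (R : Ω₂ → ℝ) (Θ : Ω₂ → (Fin d → ℝ) → ℝ≥0)
    (ω : Ω₂) : ℝ≥0∞ :=
  sojourn δ Set.univ (fun t => R ω * (Θ ω t : ℝ)) 1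

/-- `B_Z^δ([0,T]^d ∩ δℤ^d, x) = ∫_0^∞ P(∫_{[0,T]^d ∩ δℤ^d} 1{Z(t) > s} λ_δ(dt) > x) ds`. -/
def bermanPre {Ω : Type*} [MeasurableSpace Ω] (P : Measure Ω) {d : ℕ}
    (Z : Ω → (Fin d → ℝ) → ℝ≥0) (δ T x : ℝ) : ℝ≥0∞ :=
  ∫⁻ s in Set.Ioi (0 : ℝ),
    P {ω | ENNReal.ofReal x < sojourn δ (cube d T) (fun t => (Z ω t : ℝ)) s}

/-- The Berman function `B_Z^δ(x) = lim_{T → ∞} T^{-d} B_Z^δ([0,T]^d ∩ δℤ^d, x)`. -/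
def bermanFun {Ω : Type*} [MeasurableSpace Ω] (P : Measure Ω) {d : ℕ}
    (Z : Ω → (Fin d → ℝ) → ℝ≥0) (δ x : ℝ) : ℝ≥0∞ :=
  limUnder atTop (fun T : ℝ => bermanPre P Z δ T x / ENNReal.ofReal (T ^ d))

end

/-! Write ε for ε_δ(Y). Both bounds follow from the formula B_Z^δ(x) = E[1{ε > x}/ε]. The upper one
is 1{ε > x}/ε ≤ 1{ε ≥ x}/x. The lower one, when E ε < ∞, is Cauchy–Schwarz for 1{ε > x} = (1{ε >
x}/ε)^{1/2} ε^{1/2} (`sq_measure_lt_le`).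

For the formula, let ν = ∫_0^∞ P(Z/s ∈ ·) ds be the exponent measure and S_T the sojourn of a path
above 1 in [0,T]^d, so that `bermanPre` is ν(S_T > x). Write 1{S_T > x} as S_T · 1{S_T > x}/S_T,
expand the first factor as ∫ 1{f(t) > 1} λ_δ(dt), apply Fubini and shift each t to the origin
(`bermanPre_eq_lintegral`). The law of Y is ν restricted to {f(0) > 1}
(`map_multPath_eq_exceedanceLaw`), so the result is the integral over t ∈ [0,T]^d of E[1{S > x}/S],
with S the sojourn of Y in [0,T]^d - t. For t at distance n from the boundary this window contains
[-n,n]^d; letting T → ∞ and then n → ∞ gives the limit (`tendsto_bermanPre_div`).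

The shift is allowed because X is stationary: P(X(t_j) ≤ c_j for all j) = exp(-E max_j Z(t_j)/c_j)
(`measure_deHaanField_le`), the exponent is ν(f(t_j) > c_j for some j), and these values determine ν
on {f(0) > 1} (`restrict_one_lt_eq`). The distribution function is a Poisson void probability,
computed from the mean-preserving products ∏_{i ≤ n} F(Γ_i) · H(Γ_n) with H = `tailExp`
(`measure_forall_le_arrival`). -/

/-! ### The function H(u) = exp(-∫_u^∞ (1 - F)) and its one-step identity -/

/-- The function `u ↦ exp (-∫_u^∞ (1 - F))` for the distribution function `F` of `κ`. -/
noncomputable def tailExp (κ : Measure ℝ) (u : ℝ) : ℝ :=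
  Real.exp (-((∫ s in Set.Ioi 0, (1 - cdf κ s)) - ∫ s in (0 : ℝ)..u, (1 - cdf κ s)))

lemma measurable_cdf' (κ : Measure ℝ) : Measurable (fun s => cdf κ s) :=
  (monotone_cdf κ).measurable

lemma one_sub_cdf_nonneg (κ : Measure ℝ) (s : ℝ) : 0 ≤ 1 - cdf κ s :=
  sub_nonneg.2 (cdf_le_one κ s)

lemma intervalIntegrable_one_sub_cdf (κ : Measure ℝ) (a b : ℝ) :
    IntervalIntegrable (fun s => 1 - cdf κ s) volume a b :=
  intervalIntegrable_const.sub (monotone_cdf κ).intervalIntegrable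

lemma continuous_tailExp (κ : Measure ℝ) : Continuous (tailExp κ) := by
  unfold tailExp
  have := intervalIntegral.continuous_primitive (intervalIntegrable_one_sub_cdf κ) 0
  fun_prop

/-- Only a right derivative is available, since F is merely right-continuous; this suffices for the
fundamental theorem of calculus. -/
lemma hasDerivWithinAt_tailExp (κ : Measure ℝ) (u : ℝ) :
    HasDerivWithinAt (tailExp κ) (tailExp κ u * (1 - cdf κ u)) (Set.Ioi u) u := by
  have h1 : HasDerivWithinAt (fun u => ∫ s in (0 : ℝ)..u, (1 - cdf κ s)) (1 - cdf κ u)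
      (Set.Ici u) u := by
    refine intervalIntegral.integral_hasDerivWithinAt_right (t := Set.Ioi u)
      (intervalIntegrable_one_sub_cdf κ 0 u)
      (measurable_const.sub (measurable_cdf' κ)).stronglyMeasurable.stronglyMeasurableAtFilter ?_
    exact continuousWithinAt_const.sub ((cdf κ).right_continuous u |>.mono Set.Ioi_subset_Ici_self)
  have h2 := ((h1.const_sub (∫ s in Set.Ioi 0, (1 - cdf κ s))).neg).exp
  refine (h2.mono Set.Ioi_subset_Ici_self).congr_deriv ?_
  simp [tailExp]

lemma integral_one_sub_cdf_le {κ : Measure ℝ}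
    (hI : IntegrableOn (fun s => 1 - cdf κ s) (Set.Ioi 0)) {u : ℝ} (hu : 0 ≤ u) :
    ∫ s in (0 : ℝ)..u, (1 - cdf κ s) ≤ ∫ s in Set.Ioi 0, (1 - cdf κ s) := by
  rw [intervalIntegral.integral_of_le hu]
  exact setIntegral_mono_set hI (ae_of_all _ (one_sub_cdf_nonneg κ))
    (Set.Ioc_subset_Ioi_self.eventuallyLE)

lemma tailExp_le_one {κ : Measure ℝ}
    (hI : IntegrableOn (fun s => 1 - cdf κ s) (Set.Ioi 0)) {u : ℝ} (hu : 0 ≤ u) :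
    tailExp κ u ≤ 1 := by
  have := integral_one_sub_cdf_le hI hu
  exact Real.exp_le_one_iff.2 (by linarith)

lemma tendsto_tailExp {κ : Measure ℝ}
    (hI : IntegrableOn (fun s => 1 - cdf κ s) (Set.Ioi 0)) :
    Tendsto (tailExp κ) atTop (𝓝 1) := by
  have h := intervalIntegral_tendsto_integral_Ioi 0 hI tendsto_id
  have h2 := (h.const_sub (∫ s in Set.Ioi 0, (1 - cdf κ s))).neg.rexp
  simp only [id, sub_self, neg_zero, Real.exp_zero] at h2
  exact h2

lemma tailExp_nonneg (κ : Measure ℝ) (u : ℝ) : 0 ≤ tailExp κ u := (Real.exp_pos _).le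

lemma lintegral_expMeasure_one (f : ℝ → ℝ≥0∞) :
    ∫⁻ v, f v ∂(expMeasure 1) = ∫⁻ v in Set.Ioi 0, ENNReal.ofReal (Real.exp (-v)) * f v := by
  have hm : Measurable (gammaPDF 1 1) := by
    unfold gammaPDF
    exact (measurable_exponentialPDFReal 1).ennreal_ofReal
  rw [expMeasure, gammaMeasure, lintegral_withDensity_eq_lintegral_mul_non_measurable₀ _
    hm.aemeasurable (ae_of_all _ fun x => by simp [gammaPDF])]
  rw [setLIntegral_congr Ioi_ae_eq_Ici]
  rw [← lintegral_indicator measurableSet_Ici]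
  refine lintegral_congr fun v => ?_
  by_cases hv : 0 ≤ v
  · simp [Set.indicator, hv, gammaPDF, gammaPDFReal]
  · simp [Set.indicator, hv, gammaPDF, gammaPDFReal]

/-- Since H' = H(1 - F), the function v ↦ -e^{-v} H(a + v) has right derivative e^{-v} F(a + v) H(a
+ v); it runs from -H(a) at 0 to 0 at ∞. This is the martingale step when one exponential arrival is
added. -/
lemma lintegral_cdf_mul_tailExp {κ : Measure ℝ}
    (hI : IntegrableOn (fun s => 1 - cdf κ s) (Set.Ioi 0)) {a : ℝ} (ha : 0 ≤ a) :
    ∫⁻ v, ENNReal.ofReal (cdf κ (a + v) * tailExp κ (a + v)) ∂(expMeasure 1)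
      = ENNReal.ofReal (tailExp κ a) := by
  set g : ℝ → ℝ := fun v => Real.exp (-v) * (cdf κ (a + v) * tailExp κ (a + v)) with hg
  have hgm : Measurable g := by
    have h1 := (measurable_cdf' κ).comp (measurable_const_add a)
    have h2 := (continuous_tailExp κ).measurable.comp (measurable_const_add a)
    exact (by fun_prop : Measurable fun v : ℝ => Real.exp (-v)).mul (h1.mul h2)
  have hg0 : ∀ v, 0 ≤ g v := fun v =>
    mul_nonneg (Real.exp_pos _).le (mul_nonneg (cdf_nonneg κ _) (tailExp_nonneg κ _))
  have hgi : IntegrableOn g (Set.Ioi 0) := by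
    refine Integrable.mono' (integrableOn_exp_neg_Ioi 0) hgm.aestronglyMeasurable ?_
    filter_upwards [ae_restrict_mem measurableSet_Ioi] with v hv
    rw [Real.norm_of_nonneg (hg0 v)]
    have hv' : 0 ≤ a + v := add_nonneg ha (le_of_lt hv)
    have := mul_le_one₀ (cdf_le_one κ (a + v)) (tailExp_nonneg κ _) (tailExp_le_one hI hv')
    exact mul_le_of_le_one_right (Real.exp_pos _).le this
  have hint : ∫ v in Set.Ioi 0, g v = tailExp κ a := by
    have h1 := intervalIntegral_tendsto_integral_Ioi 0 hgi tendsto_id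
    have h2 : ∀ b, 0 ≤ b → ∫ v in (0 : ℝ)..b, g v
        = tailExp κ a - Real.exp (-b) * tailExp κ (a + b) := by
      intro b hb
      have h3 := intervalIntegral.integral_eq_sub_of_hasDeriv_right (a := 0) (b := b)
        (f := fun v => -(Real.exp (-v) * tailExp κ (a + v))) (f' := g) ?_ ?_ ?_
      · rw [h3]; simp; ring
      · have := continuous_tailExp κ
        exact Continuous.continuousOn (by fun_prop)
      · intro v _
        have e1 : HasDerivWithinAt (fun v => Real.exp (-v)) (-Real.exp (-v)) (Set.Ioi v) v := by
          simpa using ((hasDerivAt_id v).neg.exp).hasDerivWithinAt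
        have e2 : HasDerivWithinAt (fun v => tailExp κ (a + v))
            (tailExp κ (a + v) * (1 - cdf κ (a + v)) * 1) (Set.Ioi v) v :=
          (hasDerivWithinAt_tailExp κ (a + v)).comp v
            ((hasDerivAt_id v).const_add a).hasDerivWithinAt
            (fun w hw => by simpa using hw)
        refine (e1.mul e2).neg.congr_deriv ?_
        simp only [hg]; ring
      · rw [intervalIntegrable_iff_integrableOn_Ioc_of_le hb]
        exact hgi.mono_set Set.Ioc_subset_Ioi_self
    refine tendsto_nhds_unique h1 ?_
    have h4 : Tendsto (fun b => tailExp κ a - Real.exp (-b) * tailExp κ (a + b)) atTop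
        (𝓝 (tailExp κ a - 0 * 1)) := by
      refine tendsto_const_nhds.sub (Tendsto.mul ?_ ?_)
      · exact Real.tendsto_exp_neg_atTop_nhds_zero
      · exact (tendsto_tailExp hI).comp (tendsto_atTop_add_const_left _ a tendsto_id)
    simp only [zero_mul, sub_zero] at h4
    refine h4.congr' ?_
    filter_upwards [eventually_ge_atTop 0] with b hb
    exact (h2 b hb).symm
  rw [lintegral_expMeasure_one, ← hint, ofReal_integral_eq_lintegral_ofReal hgi
    (ae_of_all _ hg0)]
  refine lintegral_congr fun v => ?_
  rw [← ENNReal.ofReal_mul (Real.exp_pos _).le]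

lemma lintegral_exp_neg_expMeasure (a : ℝ) :
    ∫⁻ v, ENNReal.ofReal (Real.exp (-(a + v))) ∂(expMeasure 1)
      = ENNReal.ofReal (Real.exp (-a)) / 2 := by
  have h1 : ∀ v : ℝ, ENNReal.ofReal (Real.exp (-v)) * ENNReal.ofReal (Real.exp (-(a + v)))
      = ENNReal.ofReal (Real.exp (-a)) * ENNReal.ofReal (Real.exp (-2 * v)) := by
    intro v
    rw [← ENNReal.ofReal_mul (Real.exp_pos _).le, ← ENNReal.ofReal_mul (Real.exp_pos _).le,
      ← Real.exp_add, ← Real.exp_add]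
    congr 2; ring
  rw [lintegral_expMeasure_one]
  simp_rw [h1]
  rw [lintegral_const_mul _ (by fun_prop), ← ofReal_integral_eq_lintegral_ofReal
    (integrableOn_exp_mul_Ioi (by norm_num) 0) (ae_of_all _ fun v => (Real.exp_pos _).le),
    integral_exp_mul_Ioi (by norm_num) 0, div_eq_mul_inv]
  congr 1
  rw [mul_zero, Real.exp_zero, show (-1 * (-2 : ℝ)⁻¹) = (2 : ℝ)⁻¹ by norm_num,
    ENNReal.ofReal_inv_of_pos (by norm_num)]
  simp

/-! ### Void probabilities of the marked Poisson process -/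

section Records
variable {Ω₁ : Type*} [MeasurableSpace Ω₁] {P₁ : Measure Ω₁} [IsProbabilityMeasure P₁]
  {V : ℕ → Ω₁ → ℝ}

omit [IsProbabilityMeasure P₁] in
/-- The sequence `V` truncated to its first `n` entries is independent of `V n`. -/
lemma indepFun_truncate (hV : iIndepFun V P₁) (hVm : ∀ k, Measurable (V k)) (n : ℕ) :
    IndepFun (fun ω k => if k < n then V k ω else 0) (V n) P₁ := by
  have h := hV.indepFun_finset (Finset.range n) {n} (by simp) hVm
  have hφ : Measurable (fun (y : Finset.range n → ℝ) (k : ℕ) =>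
      if hk : k < n then y ⟨k, Finset.mem_range.2 hk⟩ else 0) :=
    measurable_pi_lambda _ fun k => by
      by_cases hk : k < n
      · simpa [hk] using measurable_pi_apply _
      · simp [hk]
  have hψ : Measurable (fun (y : ({n} : Finset ℕ) → ℝ) => y ⟨n, Finset.mem_singleton_self n⟩) :=
    measurable_pi_apply _
  have h2 := h.comp hφ hψ
  convert h2 using 1
  · funext ω k
    by_cases hk : k < n <;> simp [hk]
  · rfl

/-- Integrating out the last arrival. -/
lemma lintegral_truncate_prod (hV : iIndepFun V P₁) (hVm : ∀ k, Measurable (V k))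
    {ρ : Measure ℝ} (hρ : ∀ k, P₁.map (V k) = ρ) (n : ℕ)
    {f : (ℕ → ℝ) × ℝ → ℝ≥0∞} (hf : Measurable f) :
    ∫⁻ ω, f (fun k => if k < n then V k ω else 0, V n ω) ∂P₁
      = ∫⁻ ω, ∫⁻ v, f (fun k => if k < n then V k ω else 0, v) ∂ρ ∂P₁ := by
  have hU : Measurable (fun ω (k : ℕ) => if k < n then V k ω else 0) :=
    measurable_pi_lambda _ fun k => by
      by_cases hk : k < n
      · simpa [hk] using hVm k
      · simp [hk]
  have h := (indepFun_iff_map_prod_eq_prod_map_map hU.aemeasurable (hVm n).aemeasurable).1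
    (indepFun_truncate hV hVm n)
  have hρp : IsProbabilityMeasure ρ := hρ n ▸ Measure.isProbabilityMeasure_map (hVm n).aemeasurable
  rw [hρ n] at h
  rw [← lintegral_map (μ := P₁) (g := fun ω => ((fun (k : ℕ) => if k < n then V k ω else 0), V n ω))
    hf (hU.prodMk (hVm n)), h, lintegral_prod _ hf.aemeasurable, lintegral_map _ hU]
  exact hf.lintegral_prod_right'

lemma sum_truncate (y : ℕ → ℝ) {m n : ℕ} (h : m ≤ n) :
    ∑ k ∈ Finset.range m, (if k < n then y k else 0) = ∑ k ∈ Finset.range m, y k :=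
  Finset.sum_congr rfl fun _ hk => if_pos ((Finset.mem_range.1 hk).trans_le h)

omit [IsProbabilityMeasure P₁] in
lemma ae_arrival_pos (hVm : ∀ k, Measurable (V k)) (hρ : ∀ k, P₁.map (V k) = expMeasure 1) :
    ∀ᵐ ω ∂P₁, ∀ k, 0 < V k ω := by
  rw [ae_all_iff]
  intro k
  have h : ∀ᵐ v ∂(expMeasure 1), (0 : ℝ) < v := by
    have h0 : expMeasure 1 (Set.Iic 0) = 0 := by
      rw [← lintegral_indicator_one measurableSet_Iic, lintegral_expMeasure_one,
        ← lintegral_indicator measurableSet_Ioi, lintegral_eq_zero_iff' ?_]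
      · refine ae_of_all _ fun v => ?_
        by_cases hv : 0 < v <;> simp [Set.indicator, hv, not_le.2]
      · exact ((Measurable.mul (by fun_prop) (measurable_one.indicator measurableSet_Iic)).indicator
          measurableSet_Ioi).aemeasurable
    rw [ae_iff]
    convert h0 using 2
    ext v; simp
  rw [← hρ k] at h
  exact ae_of_ae_map (hVm k).aemeasurable h

/-- A quantitative form of Γ_n → ∞, used to discard the event that Γ_n stays below a fixed level. -/
lemma lintegral_exp_neg_arrival (hV : iIndepFun V P₁) (hVm : ∀ k, Measurable (V k))
    (hρ : ∀ k, P₁.map (V k) = expMeasure 1) (n : ℕ) :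
    ∫⁻ ω, ENNReal.ofReal (Real.exp (-∑ k ∈ Finset.range n, V k ω)) ∂P₁ = (2⁻¹) ^ n := by
  induction n with
  | zero => simp
  | succ n ih =>
    have h := lintegral_truncate_prod hV hVm hρ n
      (f := fun p => ENNReal.ofReal (Real.exp (-(∑ k ∈ Finset.range n, p.1 k + p.2))))
      (by fun_prop)
    simp only [sum_truncate (fun k => V k _) le_rfl, lintegral_exp_neg_expMeasure] at h
    simp only [Finset.sum_range_succ]
    rw [h]
    simp_rw [div_eq_mul_inv]
    rw [lintegral_mul_const, ih, pow_succ]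
    fun_prop

/-- The products ∏_{i ≤ n} F(Γ_i) · H(Γ_n) have constant mean: integrating out the last arrival
turns F(Γ_{n+1}) H(Γ_{n+1}) into H(Γ_n). -/
lemma lintegral_prod_cdf_mul_tailExp (hV : iIndepFun V P₁) (hVm : ∀ k, Measurable (V k))
    (hρ : ∀ k, P₁.map (V k) = expMeasure 1) {κ : Measure ℝ}
    (hI : IntegrableOn (fun s => 1 - cdf κ s) (Set.Ioi 0)) (n : ℕ) :
    ∫⁻ ω, (∏ i ∈ Finset.range n, ENNReal.ofReal (cdf κ (∑ k ∈ Finset.range (i + 1), V k ω))) *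
      ENNReal.ofReal (tailExp κ (∑ k ∈ Finset.range n, V k ω)) ∂P₁
      = ENNReal.ofReal (tailExp κ 0) := by
  induction n with
  | zero => simp
  | succ n ih =>
    rw [← ih]
    have hc := measurable_cdf' κ
    have ht := (continuous_tailExp κ).measurable
    have h := lintegral_truncate_prod hV hVm hρ n
      (f := fun p => (∏ i ∈ Finset.range n,
          ENNReal.ofReal (cdf κ (∑ k ∈ Finset.range (i + 1), p.1 k))) *
        ENNReal.ofReal (cdf κ (∑ k ∈ Finset.range n, p.1 k + p.2) *
          tailExp κ (∑ k ∈ Finset.range n, p.1 k + p.2))) (by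
        refine Measurable.mul (Finset.measurable_prod _ fun i _ => ?_) ?_
        · exact (hc.comp (by fun_prop)).ennreal_ofReal
        · exact ((hc.comp (by fun_prop)).mul (ht.comp (by fun_prop))).ennreal_ofReal)
    have e : ∀ ω, ∏ i ∈ Finset.range n, ENNReal.ofReal (cdf κ (∑ k ∈ Finset.range (i + 1),
        (if k < n then V k ω else 0)))
        = ∏ i ∈ Finset.range n, ENNReal.ofReal (cdf κ (∑ k ∈ Finset.range (i + 1), V k ω)) := by
      intro ω
      refine Finset.prod_congr rfl fun i hi => ?_
      rw [sum_truncate (fun k => V k ω) (Finset.mem_range.1 hi)]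
    simp only [e, sum_truncate (fun k => V k _) le_rfl] at h
    simp only [Finset.prod_range_succ, mul_assoc, Finset.sum_range_succ _ n,
      ← ENNReal.ofReal_mul (cdf_nonneg κ _)]
    rw [h]
    refine lintegral_congr_ae ?_
    filter_upwards [ae_arrival_pos hVm hρ] with ω hω
    have hcv : Measurable fun v => cdf κ (∑ k ∈ Finset.range n, V k ω + v) :=
      hc.comp (measurable_const_add _)
    have htv : Measurable fun v => tailExp κ (∑ k ∈ Finset.range n, V k ω + v) :=
      ht.comp (measurable_const_add _)
    rw [lintegral_const_mul _ (by fun_prop),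
      lintegral_cdf_mul_tailExp hI (Finset.sum_nonneg fun k _ => (hω k).le)]

variable {ξ : ℕ → Ω₁ → ℝ}

/-- Given the arrivals, the marks are independent with distribution function F, so the conditional
probability is a product. -/
lemma measure_forall_lt_le_arrival (hVm : ∀ k, Measurable (V k)) (hξm : ∀ k, Measurable (ξ k))
    {κ : Measure ℝ} [IsProbabilityMeasure κ] (hκ : ∀ k, P₁.map (ξ k) = κ) (hξ : iIndepFun ξ P₁)
    (hVξ : IndepFun (fun ω k => V k ω) (fun ω k => ξ k ω) P₁) (n : ℕ) :
    P₁ {ω | ∀ i < n, ξ i ω ≤ ∑ k ∈ Finset.range (i + 1), V k ω}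
      = ∫⁻ ω, ∏ i ∈ Finset.range n,
          ENNReal.ofReal (cdf κ (∑ k ∈ Finset.range (i + 1), V k ω)) ∂P₁ := by
  have hVm' : Measurable (fun ω k => V k ω) := measurable_pi_lambda _ hVm
  have hξm' : Measurable (fun ω k => ξ k ω) := measurable_pi_lambda _ hξm
  set A : Set ((ℕ → ℝ) × (ℕ → ℝ)) := {p | ∀ i < n, p.2 i ≤ ∑ k ∈ Finset.range (i + 1), p.1 k} with hA
  have hAm : MeasurableSet A := by
    have : A = ⋂ i ∈ Finset.range n, {p | p.2 i ≤ ∑ k ∈ Finset.range (i + 1), p.1 k} := by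
      ext p; simp [hA]
    rw [this]
    exact Finset.measurableSet_biInter _ fun i _ => measurableSet_le (by fun_prop) (by fun_prop)
  have h := (indepFun_iff_map_prod_eq_prod_map_map hVm'.aemeasurable hξm'.aemeasurable).1 hVξ
  have h1 : P₁ {ω | ∀ i < n, ξ i ω ≤ ∑ k ∈ Finset.range (i + 1), V k ω}
      = P₁.map (fun ω => (fun k => V k ω, fun k => ξ k ω)) A := by
    rw [Measure.map_apply (hVm'.prodMk hξm') hAm]; rfl
  have := Measure.isProbabilityMeasure_map (μ := P₁) hξm'.aemeasurable
  rw [h1, h, Measure.prod_apply hAm, lintegral_map (measurable_measure_prodMk_left hAm) hVm']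
  refine lintegral_congr fun ω => ?_
  rw [Measure.map_apply hξm' (measurable_prodMk_left hAm)]
  have h2 := hξ.measure_inter_preimage_eq_mul (Finset.range n)
    (sets := fun i => Set.Iic (∑ k ∈ Finset.range (i + 1), V k ω)) (fun i _ => measurableSet_Iic)
  have h3 : (fun ω k => ξ k ω) ⁻¹' (Prod.mk (fun k => V k ω) ⁻¹' A)
      = ⋂ i ∈ Finset.range n, ξ i ⁻¹' Set.Iic (∑ k ∈ Finset.range (i + 1), V k ω) := by
    ext ω'; simp [hA]
  rw [h3, h2]
  refine Finset.prod_congr rfl fun i _ => ?_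
  rw [ofReal_cdf, ← hκ i, Measure.map_apply (hξm i) measurableSet_Iic]

/-- The void probability of the Poisson process with points `(Γ_i, ξ_i)`, where the `Γ_i` are the
partial sums of unit exponential variables. -/
lemma measure_forall_le_arrival (hV : iIndepFun V P₁) (hVm : ∀ k, Measurable (V k))
    (hρ : ∀ k, P₁.map (V k) = expMeasure 1) (hξm : ∀ k, Measurable (ξ k))
    {κ : Measure ℝ} [IsProbabilityMeasure κ] (hκ : ∀ k, P₁.map (ξ k) = κ) (hξ : iIndepFun ξ P₁)
    (hVξ : IndepFun (fun ω k => V k ω) (fun ω k => ξ k ω) P₁)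
    (hI : IntegrableOn (fun s => 1 - cdf κ s) (Set.Ioi 0)) :
    P₁ {ω | ∀ i, ξ i ω ≤ ∑ k ∈ Finset.range (i + 1), V k ω} = ENNReal.ofReal (tailExp κ 0) := by
  set p : ℕ → ℝ≥0∞ := fun n => P₁ {ω | ∀ i < n, ξ i ω ≤ ∑ k ∈ Finset.range (i + 1), V k ω}
    with hp
  have hlim : Tendsto p atTop
      (𝓝 (P₁ {ω | ∀ i, ξ i ω ≤ ∑ k ∈ Finset.range (i + 1), V k ω})) := by
    have hm : ∀ n, MeasurableSet {ω | ∀ i < n, ξ i ω ≤ ∑ k ∈ Finset.range (i + 1), V k ω} := by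
      intro n
      have : {ω | ∀ i < n, ξ i ω ≤ ∑ k ∈ Finset.range (i + 1), V k ω}
          = ⋂ i ∈ Finset.range n, {ω | ξ i ω ≤ ∑ k ∈ Finset.range (i + 1), V k ω} := by
        ext ω; simp
      rw [this]
      exact Finset.measurableSet_biInter _ fun i _ => measurableSet_le (hξm i) (by fun_prop)
    have h := tendsto_measure_iInter_atTop (μ := P₁) (fun n => (hm n).nullMeasurableSet)
      (fun m n hmn ω hω i hi => hω i (hi.trans_le hmn)) ⟨0, measure_ne_top _ _⟩
    have heq : {ω | ∀ i, ξ i ω ≤ ∑ k ∈ Finset.range (i + 1), V k ω}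
        = ⋂ n, {ω | ∀ i < n, ξ i ω ≤ ∑ k ∈ Finset.range (i + 1), V k ω} := by
      ext ω
      rw [Set.mem_iInter]
      exact ⟨fun h n i _ => h i, fun h i => h (i + 1) i (Nat.lt_succ_self i)⟩
    rw [heq]
    exact h
  -- The mean of ∏ F(Γ_i) · H(Γ_n) is H(0), and dropping the factor H(Γ_n) ≤ 1 only increases it.
  have hlow : ∀ n, ENNReal.ofReal (tailExp κ 0) ≤ p n := by
    intro n
    rw [← lintegral_prod_cdf_mul_tailExp hV hVm hρ hI n, hp]
    simp only
    rw [measure_forall_lt_le_arrival hVm hξm hκ hξ hVξ n]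
    refine lintegral_mono_ae ?_
    filter_upwards [ae_arrival_pos hVm hρ] with ω hω
    refine mul_le_of_le_one_right' ?_
    rw [← ENNReal.ofReal_one]
    exact ENNReal.ofReal_le_ofReal (tailExp_le_one hI (Finset.sum_nonneg fun k _ => (hω k).le))
  have hup : ∀ ε : ℝ, 0 < ε → ∃ A : ℝ, ∀ n, p n ≤ ENNReal.ofReal (tailExp κ 0)
      + (ENNReal.ofReal ε + ENNReal.ofReal (Real.exp A) * (2⁻¹) ^ n) := by
    intro ε hε
    have h1 : ∀ᶠ u in atTop, 1 - ε < tailExp κ u :=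
      (tendsto_tailExp hI).eventually (lt_mem_nhds (by linarith))
    obtain ⟨A, hA⟩ := h1.exists_forall_of_atTop
    refine ⟨A, fun n => ?_⟩
    -- For u ≥ A the choice of A gives H(u) > 1 - ε; for u ≤ A already e^{A-u} ≥ 1.
    have hbound : ∀ u : ℝ, 1 ≤ ENNReal.ofReal (tailExp κ u) +
        (ENNReal.ofReal ε + ENNReal.ofReal (Real.exp A) * ENNReal.ofReal (Real.exp (-u))) := by
      intro u
      rw [← ENNReal.ofReal_mul (Real.exp_pos _).le, ← ENNReal.ofReal_add hε.le (by positivity),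
        ← ENNReal.ofReal_add (tailExp_nonneg _ _) (by positivity), ← ENNReal.ofReal_one,
        ← Real.exp_add]
      refine ENNReal.ofReal_le_ofReal ?_
      rcases le_total A u with hu | hu
      · have := hA u hu
        have := Real.exp_pos (A + -u)
        linarith
      · have := tailExp_nonneg κ u
        have : 1 ≤ Real.exp (A + -u) := Real.one_le_exp (by linarith)
        linarith
    have hc := measurable_cdf' κ
    have ht := (continuous_tailExp κ).measurable
    have hG : ∀ n, Measurable fun ω => ∑ k ∈ Finset.range n, V k ω := fun n => by fun_prop
    rw [← lintegral_prod_cdf_mul_tailExp hV hVm hρ hI n, ← lintegral_exp_neg_arrival hV hVm hρ n,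
      hp]
    simp only
    rw [measure_forall_lt_le_arrival hVm hξm hκ hξ hVξ n]
    have hconst : ENNReal.ofReal ε = ∫⁻ _, ENNReal.ofReal ε ∂P₁ := by simp
    rw [hconst, ← lintegral_const_mul _ (by fun_prop), ← lintegral_add_left measurable_const,
      ← lintegral_add_left]
    · refine lintegral_mono fun ω => ?_
      set M : ℝ≥0∞ := ∏ i ∈ Finset.range n,
        ENNReal.ofReal (cdf κ (∑ k ∈ Finset.range (i + 1), V k ω))
      have hM : M ≤ 1 := Finset.prod_le_one' fun i _ => by
        rw [← ENNReal.ofReal_one]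
        exact ENNReal.ofReal_le_ofReal (cdf_le_one κ _)
      calc M = M * 1 := (mul_one _).symm
        _ ≤ M * (ENNReal.ofReal (tailExp κ (∑ k ∈ Finset.range n, V k ω)) + (ENNReal.ofReal ε +
            ENNReal.ofReal (Real.exp A) *
              ENNReal.ofReal (Real.exp (-∑ k ∈ Finset.range n, V k ω)))) := by
          gcongr
          exact hbound (∑ k ∈ Finset.range n, V k ω)
        _ ≤ _ := by
          rw [mul_add]
          gcongr
          exact mul_le_of_le_one_left' hM
    · refine Measurable.mul (Finset.measurable_prod _ fun i _ => ?_) ?_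
      · exact (hc.comp (hG _)).ennreal_ofReal
      · exact (ht.comp (hG _)).ennreal_ofReal
  refine le_antisymm ?_ (ge_of_tendsto' hlim hlow)
  refine ENNReal.le_of_forall_pos_le_add fun ε hε _ => ?_
  obtain ⟨A, hA⟩ := hup ε hε
  have h2 : Tendsto (fun n : ℕ => ENNReal.ofReal (tailExp κ 0) + (ENNReal.ofReal (ε : ℝ)
      + ENNReal.ofReal (Real.exp A) * (2⁻¹ : ℝ≥0∞) ^ n)) atTop
      (𝓝 (ENNReal.ofReal (tailExp κ 0) + (ENNReal.ofReal (ε : ℝ)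
        + ENNReal.ofReal (Real.exp A) * 0))) := by
    refine tendsto_const_nhds.add (tendsto_const_nhds.add ?_)
    refine ENNReal.Tendsto.const_mul ?_ (Or.inr ENNReal.ofReal_ne_top)
    exact ENNReal.tendsto_pow_atTop_nhds_zero_of_lt_one (by simp)
  have := le_of_tendsto_of_tendsto' hlim h2 hA
  simpa using this

end Records

/-! ### Measurable versions of sojourns, and the measures λ_δ -/

section Regularisation
variable {d : ℕ}

/-- The smallest point of the lattice `(n + 1)⁻¹ ℤ^d` that is strictly above `t`. -/
noncomputable def upperGrid (n : ℕ) (t : Fin d → ℝ) : Fin d → ℝ :=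
  fun i => ((⌊((n : ℝ) + 1) * t i⌋ : ℝ) + 1) / ((n : ℝ) + 1)

/-- A version of the path `f` that is jointly measurable in the path and the argument. -/
noncomputable def regPath (f : (Fin d → ℝ) → ℝ≥0) (t : Fin d → ℝ) : ℝ≥0∞ :=
  liminf (fun n => (f (upperGrid n t) : ℝ≥0∞)) atTop

lemma lt_upperGrid (n : ℕ) (t : Fin d → ℝ) (i : Fin d) : t i < upperGrid n t i := by
  have hn : (0 : ℝ) < (n : ℝ) + 1 := by positivity
  rw [upperGrid, lt_div_iff₀ hn, mul_comm]
  exact Int.lt_floor_add_one _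

lemma upperGrid_le (n : ℕ) (t : Fin d → ℝ) (i : Fin d) :
    upperGrid n t i ≤ t i + 1 / ((n : ℝ) + 1) := by
  have hn : (0 : ℝ) < (n : ℝ) + 1 := by positivity
  rw [upperGrid, add_div, div_eq_mul_inv (_ : ℝ) ((n : ℝ) + 1)]
  gcongr
  rw [← div_eq_mul_inv, div_le_iff₀ hn, mul_comm (t i)]
  exact Int.floor_le _

lemma tendsto_upperGrid (t : Fin d → ℝ) :
    Tendsto (fun n => upperGrid n t) atTop (𝓝 t) := by
  rw [tendsto_pi_nhds]
  intro i
  refine tendsto_of_tendsto_of_tendsto_of_le_of_le tendsto_const_nhds ?_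
    (fun n => (lt_upperGrid n t i).le) (fun n => upperGrid_le n t i)
  simpa using tendsto_one_div_add_atTop_nhds_zero_nat.const_add (t i)

/-- The quadrant with `E` everything contains `t`, so the limit there is `f t`; the grid points
approach `t` from inside it. -/
lemma IsCadlag.regPath_eq {f : (Fin d → ℝ) → ℝ≥0} (hf : IsCadlag f) (t : Fin d → ℝ) :
    regPath f t = f t := by
  obtain ⟨l, hl⟩ := hf t Set.univ
  simp only [Set.mem_univ, forall_const, not_true_eq_false, false_imp_iff, and_true] at hl
  have hlt : f t = l := by
    have hmem : t ∈ {s : Fin d → ℝ | ∀ i, t i ≤ s i} := fun i => le_refl (t i)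
    exact tendsto_nhds_unique (tendsto_pure_nhds f t) (hl.mono_left (pure_le_nhdsWithin hmem))
  have h : Tendsto (fun n => f (upperGrid n t)) atTop (𝓝 (f t)) := by
    rw [hlt]
    refine hl.comp (tendsto_nhdsWithin_iff.2 ⟨tendsto_upperGrid t, Eventually.of_forall ?_⟩)
    exact fun n i => (lt_upperGrid n t i).le
  exact (ENNReal.tendsto_coe.2 h).liminf_eq

/-- Each approximation reads the path only at points of a countable lattice, which yields joint
measurability for the product σ-field on all paths. -/
lemma measurable_regPath :
    Measurable (fun p : ((Fin d → ℝ) → ℝ≥0) × (Fin d → ℝ) => regPath p.1 p.2) := by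
  refine Measurable.liminf fun n => ?_
  have h1 : Measurable (fun p : ((Fin d → ℝ) → ℝ≥0) × (Fin d → ℤ) =>
      (p.1 (fun i => ((p.2 i : ℝ) + 1) / ((n : ℝ) + 1)) : ℝ≥0∞)) :=
    measurable_from_prod_countable_left fun k => (measurable_pi_apply (fun i => ((k i : ℝ) + 1) / ((n : ℝ) + 1))).coe_nnreal_ennreal
  have h2 : Measurable (fun p : ((Fin d → ℝ) → ℝ≥0) × (Fin d → ℝ) =>
      (p.1, fun i => ⌊((n : ℝ) + 1) * p.2 i⌋)) := by
    refine measurable_fst.prodMk (measurable_pi_lambda _ fun i => ?_)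
    exact Int.measurable_floor.comp
      (((measurable_pi_apply i).comp measurable_snd).const_mul _)
  exact h1.comp h2

instance (δ : ℝ) : SFinite (gridMeasure d δ) := by
  unfold gridMeasure
  split_ifs <;> infer_instance

/-- The measurable version of the sojourn above the level one, as a functional of the path. -/
noncomputable def regSojourn (δ : ℝ) (A : Set (Fin d → ℝ)) (f : (Fin d → ℝ) → ℝ≥0) : ℝ≥0∞ :=
  gridMeasure d δ (A ∩ {t | 1 < regPath f t})

lemma measurable_regSojourn (δ : ℝ) {A : Set (Fin d → ℝ)} (hA : MeasurableSet A) :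
    Measurable (regSojourn δ A) := by
  have hs : MeasurableSet {p : ((Fin d → ℝ) → ℝ≥0) × (Fin d → ℝ) | p.2 ∈ A ∧ 1 < regPath p.1 p.2} :=
    (measurable_snd hA).inter (measurableSet_lt measurable_const measurable_regPath)
  exact measurable_measure_prodMk_left hs

lemma IsCadlag.regSojourn_eq {f : (Fin d → ℝ) → ℝ≥0} (hf : IsCadlag f) (δ : ℝ)
    (A : Set (Fin d → ℝ)) :
    regSojourn δ A f = gridMeasure d δ (A ∩ {t | 1 < f t}) := by
  simp [regSojourn, hf.regPath_eq]

lemma IsCadlag.comp_add {f : (Fin d → ℝ) → ℝ≥0} (hf : IsCadlag f) (h : Fin d → ℝ) :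
    IsCadlag (fun t => f (t + h)) := by
  intro t E
  obtain ⟨l, hl⟩ := hf (t + h) E
  refine ⟨l, hl.comp (tendsto_nhdsWithin_iff.2 ⟨?_, ?_⟩)⟩
  · exact ((continuous_add_const h).tendsto t).mono_left nhdsWithin_le_nhds
  · filter_upwards [self_mem_nhdsWithin] with s hs i
    simpa using hs i

lemma IsCadlag.comp_mul {f : (Fin d → ℝ) → ℝ≥0} (hf : IsCadlag f) (c : ℝ≥0) :
    IsCadlag (fun t => c * f t) := by
  intro t E
  obtain ⟨l, hl⟩ := hf t E
  exact ⟨c * l, hl.const_mul c⟩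

/-- For almost all `t`, that is for `t ∈ δℤ^d`, the measure `λ_δ` is invariant under the shift
by `t`. -/
lemma ae_measurePreserving_gridMeasure (δ : ℝ) :
    ∀ᵐ t ∂(gridMeasure d δ),
      MeasurePreserving (fun u => u + t) (gridMeasure d δ) (gridMeasure d δ) := by
  unfold gridMeasure
  split_ifs with h
  · exact ae_of_all _ fun t => measurePreserving_add_right volume t
  · refine Measure.ae_smul_measure ?_ _
    rw [Measure.ae_sum_eq, Filter.eventually_iSup]
    intro k
    rw [ae_dirac_eq, eventually_pure]
    have hm : Measurable (fun u : Fin d → ℝ => u + fun i => δ * (k i : ℝ)) := measurable_add_const _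
    refine ⟨hm, ?_⟩
    rw [Measure.map_smul, Measure.map_sum hm.aemeasurable]
    conv_rhs => rw [← Measure.sum_comp_equiv (Equiv.addRight k)]
    congr 2
    funext j
    rw [Measure.map_dirac]
    congr 1
    funext i
    simp [mul_add]

/-- The number of lattice points per coordinate is ⌊b/δ⌋ + 1 - ⌈a/δ⌉; `hab` prevents truncation at
zero. -/
lemma gridMeasure_Icc_of_ne_zero {δ : ℝ} (hδ : 0 < δ) {a b : ℝ}
    (hab : 0 ≤ ⌊b / δ⌋ + 1 - ⌈a / δ⌉) :
    gridMeasure d δ (Set.Icc (fun _ => a) (fun _ => b))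
      = ENNReal.ofReal ((δ * ((⌊b / δ⌋ : ℝ) + 1 - ⌈a / δ⌉)) ^ d) := by
  have hm : Measurable (fun (k : Fin d → ℤ) (i : Fin d) => δ * (k i : ℝ)) := measurable_of_countable _
  have h1 : Measure.sum (fun k : Fin d → ℤ => Measure.dirac (fun i => δ * (k i : ℝ)))
      = Measure.map (fun (k : Fin d → ℤ) (i : Fin d) => δ * (k i : ℝ)) Measure.count := by
    rw [Measure.count, Measure.map_sum hm.aemeasurable]
    congr 1
    funext k
    rw [Measure.map_dirac' hm]
  have h2 : (fun (k : Fin d → ℤ) (i : Fin d) => δ * (k i : ℝ)) ⁻¹'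
      Set.Icc (fun _ => a) (fun _ => b)
      = ((Fintype.piFinset fun _ : Fin d => Finset.Icc ⌈a / δ⌉ ⌊b / δ⌋ : Finset (Fin d → ℤ)) :
        Set (Fin d → ℤ)) := by
    ext k
    simp only [Set.mem_preimage, Set.mem_Icc, Pi.le_def, Finset.mem_coe, Fintype.mem_piFinset,
      Finset.mem_Icc, Int.ceil_le, Int.le_floor, div_le_iff₀ hδ, le_div_iff₀ hδ, ← forall_and,
      mul_comm δ]
  rw [gridMeasure, if_neg hδ.ne', h1, Measure.smul_apply, Measure.map_apply hm measurableSet_Icc,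
    h2, Measure.count_apply_finset, Fintype.card_piFinset]
  simp only [Int.card_Icc, Finset.prod_const, Finset.card_univ, Fintype.card_fin, smul_eq_mul]
  have h3 : (((⌊b / δ⌋ + 1 - ⌈a / δ⌉).toNat : ℕ) : ℝ) = (⌊b / δ⌋ : ℝ) + 1 - ⌈a / δ⌉ := by
    have := Int.toNat_of_nonneg hab
    exact_mod_cast congrArg (fun z : ℤ => (z : ℝ)) this
  rw [mul_pow, ENNReal.ofReal_mul (by positivity), ← h3, ← Nat.cast_pow, ENNReal.ofReal_natCast]

/-- `g` is the effective side length of the box, which treats the continuous and the lattice case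
alike. -/
lemma gridMeasure_Icc_eventually {δ : ℝ} (hδ : 0 ≤ δ) (c : ℝ) :
    ∃ g : ℝ → ℝ, (∀ᶠ T in atTop, gridMeasure d δ (Set.Icc (fun _ => c) (fun _ => T - c))
      = ENNReal.ofReal (g T ^ d)) ∧ Tendsto (fun T => g T / T) atTop (𝓝 1) := by
  have hlim : ∀ e : ℝ, Tendsto (fun T : ℝ => (T - 2 * c + e) / T) atTop (𝓝 1) := by
    intro e
    have h : Tendsto (fun T : ℝ => 1 + (e - 2 * c) * T⁻¹) atTop (𝓝 (1 + (e - 2 * c) * 0)) :=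
      tendsto_const_nhds.add (tendsto_inv_atTop_zero.const_mul _)
    rw [mul_zero, add_zero] at h
    refine h.congr' ?_
    filter_upwards [eventually_gt_atTop 0] with T hT
    field_simp
    ring
  rcases hδ.eq_or_lt with rfl | hδ
  · refine ⟨fun T => T - 2 * c + 0, ?_, hlim 0⟩
    filter_upwards [eventually_ge_atTop (2 * c)] with T hT
    rw [gridMeasure, if_pos rfl, Real.volume_Icc_pi]
    simp only [Finset.prod_const, Finset.card_univ, Fintype.card_fin]
    rw [← ENNReal.ofReal_pow (by linarith)]
    ring_nf
  · refine ⟨fun T => δ * ((⌊(T - c) / δ⌋ : ℝ) + 1 - ⌈c / δ⌉), ?_, ?_⟩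
    · filter_upwards [eventually_ge_atTop (2 * c + δ)] with T hT
      refine gridMeasure_Icc_of_ne_zero hδ ?_
      have h1 := Int.lt_floor_add_one ((T - c) / δ)
      have h2 := Int.ceil_lt_add_one (c / δ)
      have h3 : c / δ + 1 ≤ (T - c) / δ := by
        rw [div_add_one hδ.ne']; gcongr; linarith
      have : (⌈c / δ⌉ : ℝ) < ⌊(T - c) / δ⌋ + 1 := by linarith
      have : ⌈c / δ⌉ < ⌊(T - c) / δ⌋ + 1 := by exact_mod_cast this
      linarith
    -- Rounding at the two ends places the effective side length between T - 2c - δ and T - 2c + δ.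
    · refine tendsto_of_tendsto_of_tendsto_of_le_of_le' (hlim (-δ)) (hlim δ) ?_ ?_
      · filter_upwards [eventually_gt_atTop 0] with T hT
        gcongr
        have h1 := Int.lt_floor_add_one ((T - c) / δ)
        have h2 := Int.ceil_lt_add_one (c / δ)
        have e1 : δ * ((T - c) / δ) = T - c := by field_simp
        have e2 : δ * (c / δ) = c := by field_simp
        nlinarith
      · filter_upwards [eventually_gt_atTop 0] with T hT
        gcongr
        have h1 := Int.floor_le ((T - c) / δ)
        have h2 := Int.le_ceil (c / δ)
        have e1 : δ * ((T - c) / δ) = T - c := by field_simp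
        have e2 : δ * (c / δ) = c := by field_simp
        nlinarith

lemma tendsto_gridMeasure_Icc_div {δ : ℝ} (hδ : 0 ≤ δ) (c : ℝ) :
    Tendsto (fun T : ℝ => gridMeasure d δ (Set.Icc (fun _ => c) (fun _ => T - c))
      / ENNReal.ofReal (T ^ d)) atTop (𝓝 1) := by
  obtain ⟨g, hg, hlim⟩ := gridMeasure_Icc_eventually (d := d) hδ c
  have h := ENNReal.tendsto_ofReal (hlim.pow d)
  rw [one_pow, ENNReal.ofReal_one] at h
  refine h.congr' ?_
  filter_upwards [hg, eventually_gt_atTop 0] with T h1 h2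
  rw [h1, div_pow, ENNReal.ofReal_div_of_pos (by positivity)]

end Regularisation

/-! ### Exceedance events determine a measure where a coordinate exceeds one -/

section Exceedance
variable {ι : Type*}

lemma measurableSet_forall_le {n : ℕ} (t : Fin n → ι) (c : Fin n → ℝ≥0) :
    MeasurableSet {f : ι → ℝ≥0 | ∀ j, f (t j) ≤ c j} := by
  have : {f : ι → ℝ≥0 | ∀ j, f (t j) ≤ c j} = ⋂ j, {f | f (t j) ≤ c j} := by ext; simp
  rw [this]
  exact MeasurableSet.iInter fun j => measurableSet_le (measurable_pi_apply _) measurable_const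

lemma measurableSet_exists_lt {n : ℕ} (t : Fin n → ι) (c : Fin n → ℝ≥0) :
    MeasurableSet {f : ι → ℝ≥0 | ∃ j, c j < f (t j)} := by
  have : {f : ι → ℝ≥0 | ∃ j, c j < f (t j)} = ⋃ j, {f | c j < f (t j)} := by ext; simp
  rw [this]
  exact MeasurableSet.iUnion fun j => measurableSet_lt measurable_const (measurable_pi_apply _)

lemma measurableSet_one_lt (i : ι) : MeasurableSet {f : ι → ℝ≥0 | 1 < f i} :=
  measurableSet_lt measurable_const (measurable_pi_apply i)

/-- Positive levels suffice because {g ≤ c} is the intersection of the sets {g ≤ c + 1/(n+1)}. Level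
0 must be avoided later: exceeding it may have infinite exponent measure. -/
lemma measurable_of_forall_pos_le {α : Type*} [MeasurableSpace α] {g : α → ℝ≥0}
    (hg : ∀ c, 0 < c → MeasurableSet {x | g x ≤ c}) : Measurable g := by
  refine measurable_of_Iic fun c => ?_
  have : g ⁻¹' Set.Iic c = ⋂ n : ℕ, {x | g x ≤ c + 1 / ((n : ℝ≥0) + 1)} := by
    ext x
    rw [Set.mem_iInter]
    constructor
    · intro h n
      exact le_add_right (show g x ≤ c from h)
    · intro h
      have hl : Tendsto (fun n : ℕ => c + 1 / ((n : ℝ≥0) + 1)) atTop (𝓝 (c + 0)) :=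
        tendsto_const_nhds.add tendsto_one_div_add_atTop_nhds_zero_nat
      rw [add_zero] at hl
      exact ge_of_tendsto' hl h
  rw [this]
  exact MeasurableSet.iInter fun n => hg _ (by positivity)

/-- The sets of paths that stay below finitely many positive levels. -/
def levelBoxes (ι : Type*) : Set (Set (ι → ℝ≥0)) :=
  {S | ∃ (n : ℕ) (t : Fin n → ι) (c : Fin n → ℝ≥0), (∀ j, 0 < c j) ∧
    S = {f | ∀ j, f (t j) ≤ c j}}

lemma isPiSystem_levelBoxes : IsPiSystem (levelBoxes ι) := by
  rintro _ ⟨n, t, c, hc, rfl⟩ _ ⟨m, t', c', hc', rfl⟩ _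
  refine ⟨n + m, Fin.append t t', Fin.append c c', fun j => ?_, ?_⟩
  · refine Fin.addCases (fun i => ?_) (fun i => ?_) j
    · simpa using hc i
    · simpa using hc' i
  · ext f
    constructor
    · rintro ⟨h1, h2⟩ j
      refine Fin.addCases (fun i => ?_) (fun i => ?_) j
      · simpa using h1 i
      · simpa using h2 i
    · intro h
      exact ⟨fun i => by simpa using h (Fin.castAdd m i), fun i => by simpa using h (Fin.natAdd n i)⟩

lemma generateFrom_levelBoxes :
    (MeasurableSpace.pi : MeasurableSpace (ι → ℝ≥0)) =
      MeasurableSpace.generateFrom (levelBoxes ι) := by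
  apply le_antisymm
  · refine iSup_le fun i => ?_
    rw [← measurable_iff_comap_le]
    refine @measurable_of_forall_pos_le _ (MeasurableSpace.generateFrom (levelBoxes ι)) _
      fun c hc => ?_
    refine MeasurableSpace.measurableSet_generateFrom ⟨1, fun _ => i, fun _ => c, fun _ => hc, ?_⟩
    ext f; simp
  · refine MeasurableSpace.generateFrom_le ?_
    rintro _ ⟨n, t, c, -, rfl⟩
    exact measurableSet_forall_le t c

/-- Adding the constraint f(i) > 1 to an exceedance event adds exactly the paths above 1 at `i` that
stay below all the other levels. Subtracting then gives the measure of boxes inside {f(i) > 1}. -/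
lemma measure_restrict_one_lt_add (m : Measure (ι → ℝ≥0)) (i : ι) {n : ℕ} (t : Fin n → ι)
    (c : Fin n → ℝ≥0) :
    m.restrict {f | 1 < f i} {f | ∀ j, f (t j) ≤ c j} + m {f | ∃ j, c j < f (t j)}
      = m {f | ∃ j, (Fin.cons 1 c : Fin (n + 1) → ℝ≥0) j < f ((Fin.cons i t : Fin (n + 1) → ι) j)} := by
  rw [Measure.restrict_apply (measurableSet_forall_le t c),
    ← measure_union _ (measurableSet_exists_lt t c)]
  · congr 1
    ext f
    change ((∀ j, f (t j) ≤ c j) ∧ 1 < f i) ∨ (∃ j, c j < f (t j)) ↔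
      ∃ j, (Fin.cons 1 c : Fin (n + 1) → ℝ≥0) j < f ((Fin.cons i t : Fin (n + 1) → ι) j)
    rw [Fin.exists_fin_succ]
    simp only [Fin.cons_zero, Fin.cons_succ]
    by_cases h : ∃ j, c j < f (t j)
    · simp [h]
    · have h' := h
      push Not at h'
      simp [h']
  · rw [Set.disjoint_left]
    rintro f ⟨h1, _⟩ ⟨j, hj⟩
    exact absurd (h1 j) (not_le.2 hj)

/-- Measures on paths with the same finite values on exceedance events agree on paths that are
above level one at a given point. -/
lemma restrict_one_lt_eq {m m' : Measure (ι → ℝ≥0)}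
    (hfin : ∀ (n : ℕ) (t : Fin n → ι) (c : Fin n → ℝ≥0), (∀ j, 0 < c j) →
      m {f | ∃ j, c j < f (t j)} ≠ ∞)
    (h : ∀ (n : ℕ) (t : Fin n → ι) (c : Fin n → ℝ≥0), (∀ j, 0 < c j) →
      m {f | ∃ j, c j < f (t j)} = m' {f | ∃ j, c j < f (t j)}) (i : ι) :
    m.restrict {f | 1 < f i} = m'.restrict {f | 1 < f i} := by
  have hbox : ∀ (n : ℕ) (t : Fin n → ι) (c : Fin n → ℝ≥0), (∀ j, 0 < c j) →
      m.restrict {f | 1 < f i} {f | ∀ j, f (t j) ≤ c j}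
        = m'.restrict {f | 1 < f i} {f | ∀ j, f (t j) ≤ c j} := by
    intro n t c hc
    have h1 := measure_restrict_one_lt_add m i t c
    have h2 := measure_restrict_one_lt_add m' i t c
    rw [← h _ _ _ hc, ← h (n + 1) _ _ (fun j => Fin.cases one_pos hc j), ← h1] at h2
    exact ((ENNReal.add_left_inj (hfin n t c hc)).1 h2).symm
  have huniv : ∀ m : Measure (ι → ℝ≥0), m.restrict {f | 1 < f i} Set.univ
      = m.restrict {f | 1 < f i} {f | ∀ j : Fin 0, f (j.elim0 : ι) ≤ 1} := by
    intro m; congr 1; ext f; simp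
  have hf : IsFiniteMeasure (m.restrict {f | 1 < f i}) := by
    refine ⟨?_⟩
    rw [Measure.restrict_apply_univ]
    have := hfin 1 (fun _ => i) (fun _ => 1) (fun _ => one_pos)
    simpa [lt_top_iff_ne_top] using this
  refine ext_of_generate_finite _ generateFrom_levelBoxes isPiSystem_levelBoxes ?_ ?_
  · rintro _ ⟨n, t, c, hc, rfl⟩
    exact hbox n t c hc
  · rw [huniv, huniv]
    exact hbox 0 (fun j => j.elim0) (fun _ => 1) (fun _ => one_pos)

end Exceedance

/-! ### The exponent measure and its shift invariance -/

section ExponentMeasure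
variable {Ω : Type*} [MeasurableSpace Ω] {P : Measure Ω} {d : ℕ} {Z : Ω → (Fin d → ℝ) → ℝ≥0}

/-- The path `Z / s`. -/
noncomputable def scaledPath (Z : Ω → (Fin d → ℝ) → ℝ≥0) (p : Ω × ℝ) : (Fin d → ℝ) → ℝ≥0 :=
  fun t => Z p.1 t / p.2.toNNReal

/-- The exponent measure `∫_0^∞ P(Z / s ∈ ·) ds` of the max-stable field with spectral field `Z`. -/
noncomputable def exponentMeasure (P : Measure Ω) (Z : Ω → (Fin d → ℝ) → ℝ≥0) :
    Measure ((Fin d → ℝ) → ℝ≥0) :=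
  (P.prod (volume.restrict (Set.Ioi 0))).map (scaledPath Z)

lemma measurable_scaledPath (hZ : ∀ t, Measurable (fun ω => Z ω t)) : Measurable (scaledPath Z) :=
  measurable_pi_lambda _ fun t =>
    ((hZ t).comp measurable_fst).div (measurable_real_toNNReal.comp measurable_snd)

instance [SFinite P] : SFinite (exponentMeasure P Z) := by
  unfold exponentMeasure; infer_instance

/-- The largest of the ratios `f (t j) / c j`. -/
noncomputable def maxRatio {n : ℕ} (t : Fin n → Fin d → ℝ) (c : Fin n → ℝ≥0)
    (f : (Fin d → ℝ) → ℝ≥0) : ℝ≥0 :=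
  Finset.univ.sup fun j => f (t j) / c j

lemma measurable_maxRatio {n : ℕ} (t : Fin n → Fin d → ℝ) (c : Fin n → ℝ≥0) :
    Measurable (maxRatio t c) := by
  refine measurable_of_Iic fun a => ?_
  have : maxRatio t c ⁻¹' Set.Iic a = ⋂ j, {f | f (t j) / c j ≤ a} := by
    ext f; simp [maxRatio]
  rw [this]
  refine MeasurableSet.iInter fun j => measurableSet_le ?_ measurable_const
  have h : Measurable fun f : (Fin d → ℝ) → ℝ≥0 => f (t j) := measurable_pi_apply (t j)
  exact h.div_const (c j)

/-- For fixed ω, the scales s at which Z/s exceeds some level form the interval (0, max_j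
Z(t_j)/c_j), whose length is the ratio itself. -/
lemma exponentMeasure_exists_lt [SFinite P] (hZ : ∀ t, Measurable (fun ω => Z ω t)) {n : ℕ}
    (t : Fin n → Fin d → ℝ) (c : Fin n → ℝ≥0) (hc : ∀ j, 0 < c j) :
    exponentMeasure P Z {f | ∃ j, c j < f (t j)} = ∫⁻ ω, (maxRatio t c (Z ω) : ℝ≥0∞) ∂P := by
  have hm := measurable_scaledPath hZ
  have hs := measurableSet_exists_lt t c
  rw [exponentMeasure, Measure.map_apply hm hs, Measure.prod_apply (hm hs)]
  refine lintegral_congr fun ω => ?_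
  have hset : Prod.mk ω ⁻¹' (scaledPath Z ⁻¹' {f | ∃ j, c j < f (t j)}) ∩ Set.Ioi 0
      = Set.Ioo 0 (maxRatio t c (Z ω) : ℝ) := by
    ext s
    change (∃ j, c j < Z ω (t j) / s.toNNReal) ∧ 0 < s ↔ 0 < s ∧ s < (maxRatio t c (Z ω) : ℝ)
    rw [and_comm]
    refine and_congr_right fun hs0 => ?_
    have hs1 : 0 < s.toNNReal := Real.toNNReal_pos.2 hs0
    rw [← Real.toNNReal_lt_iff_lt_coe hs0.le, maxRatio, Finset.lt_sup_iff]
    simp only [Finset.mem_univ, true_and]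
    refine exists_congr fun j => ?_
    rw [lt_div_iff₀ hs1, lt_div_iff₀ (hc j), mul_comm]
  rw [Measure.restrict_apply (measurable_prodMk_left (hm hs)), hset, Real.volume_Ioo, sub_zero,
    ENNReal.ofReal_coe_nnreal]

lemma lintegral_maxRatio_ne_top (hZ : IsSpectralField P Z) {n : ℕ}
    (t : Fin n → Fin d → ℝ) (c : Fin n → ℝ≥0) :
    ∫⁻ ω, (maxRatio t c (Z ω) : ℝ≥0∞) ∂P ≠ ∞ := by
  have hle : ∀ ω, (maxRatio t c (Z ω) : ℝ≥0∞) ≤ ∑ j, (Z ω (t j) : ℝ≥0∞) * ((c j)⁻¹ : ℝ≥0) := by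
    intro ω
    have : maxRatio t c (Z ω) ≤ ∑ j, Z ω (t j) * (c j)⁻¹ := by
      refine Finset.sup_le fun j _ => ?_
      rw [div_eq_mul_inv]
      exact Finset.single_le_sum (f := fun j => Z ω (t j) * (c j)⁻¹) (fun _ _ => zero_le)
        (Finset.mem_univ j)
    exact_mod_cast this
  refine ((lintegral_mono hle).trans_lt ?_).ne
  rw [lintegral_finsetSum _ fun j _ => (hZ.measurable (t j)).coe_nnreal_ennreal.mul_const _]
  refine ENNReal.sum_lt_top.2 fun j _ => ?_
  rw [lintegral_mul_const _ (hZ.measurable (t j)).coe_nnreal_ennreal, hZ.mean_one, one_mul]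
  exact ENNReal.coe_lt_top

/-- The layer-cake formula identifies ∫_0^∞ (1 - F) with the mean. -/
lemma integral_one_sub_cdf {κ : Measure ℝ} [IsProbabilityMeasure κ] (h0 : 0 ≤ᵐ[κ] id)
    (hfin : ∫⁻ x, ENNReal.ofReal x ∂κ ≠ ∞) :
    IntegrableOn (fun s => 1 - cdf κ s) (Set.Ioi 0) ∧
      tailExp κ 0 = Real.exp (-(∫⁻ x, ENNReal.ofReal x ∂κ).toReal) := by
  have h1 : ∀ s, ENNReal.ofReal (1 - cdf κ s) = κ {x | s < x} := by
    intro s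
    rw [ENNReal.ofReal_sub _ (cdf_nonneg κ s), ofReal_cdf, ENNReal.ofReal_one,
      ← prob_compl_eq_one_sub measurableSet_Iic, Set.compl_Iic]
    rfl
  have h2 := lintegral_eq_lintegral_meas_lt κ h0 measurable_id.aemeasurable
  simp only [id, ← h1] at h2
  have hm : Measurable fun s => 1 - cdf κ s := measurable_const.sub (measurable_cdf' κ)
  have hI : IntegrableOn (fun s => 1 - cdf κ s) (Set.Ioi 0) := by
    refine ⟨hm.aestronglyMeasurable, ?_⟩
    rw [hasFiniteIntegral_iff_ofReal (ae_of_all _ (one_sub_cdf_nonneg κ)), ← h2]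
    exact lt_top_iff_ne_top.2 hfin
  refine ⟨hI, ?_⟩
  rw [tailExp, integral_eq_lintegral_of_nonneg_ae (ae_of_all _ (one_sub_cdf_nonneg κ))
    hm.aestronglyMeasurable, ← h2]
  simp

variable {Ω₁ : Type*} [MeasurableSpace Ω₁] {P₁ : Measure Ω₁}
  {V : ℕ → Ω₁ → ℝ} {W : ℕ → Ω₁ → (Fin d → ℝ) → ℝ≥0}

/-- The finite-dimensional distribution functions of the max-stable field. -/
lemma measure_deHaanField_le [IsProbabilityMeasure P] [IsProbabilityMeasure P₁]
    (hZ : IsSpectralField P Z)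
    (hVW : IsDeHaanSample P Z P₁ V W) {n : ℕ} (t : Fin n → Fin d → ℝ) (c : Fin n → ℝ≥0)
    (hc : ∀ j, 0 < c j) :
    P₁ {ω | ∀ j, deHaanField V W (t j) ω ≤ c j}
      = ENNReal.ofReal (Real.exp (-(∫⁻ ω, (maxRatio t c (Z ω) : ℝ≥0∞) ∂P).toReal)) := by
  have hZm : Measurable Z := measurable_pi_lambda _ hZ.measurable
  have hφ : Measurable (fun f => (maxRatio t c f : ℝ)) := (measurable_maxRatio t c).coe_nnreal_real
  have hφZ : Measurable (fun ω => (maxRatio t c (Z ω) : ℝ)) := hφ.comp hZm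
  set κ : Measure ℝ := P.map (fun ω => (maxRatio t c (Z ω) : ℝ)) with hκdef
  have hκp : IsProbabilityMeasure κ :=
    Measure.isProbabilityMeasure_map hφZ.aemeasurable
  have hκ : ∀ k, P₁.map (fun ω => (maxRatio t c (W k ω) : ℝ)) = κ := by
    intro k
    have h := congrArg (Measure.map (fun f => (maxRatio t c f : ℝ))) (hVW.law_W k)
    rwa [Measure.map_map hφ (hVW.measurable_W k), Measure.map_map hφ hZm] at h
  have h0 : 0 ≤ᵐ[κ] id := by
    refine (ae_map_iff hφZ.aemeasurable (measurableSet_le measurable_const measurable_id)).2 ?_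
    exact ae_of_all _ fun ω => NNReal.coe_nonneg _
  have hmean : ∫⁻ x, ENNReal.ofReal x ∂κ = ∫⁻ ω, (maxRatio t c (Z ω) : ℝ≥0∞) ∂P := by
    rw [hκdef, lintegral_map ENNReal.measurable_ofReal hφZ]
    simp
  obtain ⟨hI, hexp⟩ := integral_one_sub_cdf h0
    (by rw [hmean]; exact lintegral_maxRatio_ne_top hZ t c)
  have hW : iIndepFun (fun k ω => (maxRatio t c (W k ω) : ℝ)) P₁ :=
    hVW.indep_W.comp (fun _ f => (maxRatio t c f : ℝ)) fun _ => hφ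
  have hind : IndepFun (fun ω k => V k ω) (fun ω k => (maxRatio t c (W k ω) : ℝ)) P₁ := by
    have hψ : Measurable (fun (w : ℕ → (Fin d → ℝ) → ℝ≥0) k => (maxRatio t c (w k) : ℝ)) :=
      measurable_pi_lambda _ fun k => hφ.comp (measurable_pi_apply k)
    exact hVW.indep_VW.comp measurable_id hψ
  have hWm : ∀ k, Measurable (fun ω => (maxRatio t c (W k ω) : ℝ)) :=
    fun k => hφ.comp (hVW.measurable_W k)
  rw [← hmean, ← hexp, ← measure_forall_le_arrival hVW.indep_V hVW.measurable_V hVW.law_V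
    hWm hκ hW hind hI]
  refine measure_congr ?_
  filter_upwards [ae_arrival_pos hVW.measurable_V hVW.law_V] with ω hω
  have hΓ : ∀ i, 0 < ∑ k ∈ Finset.range (i + 1), V k ω := fun i =>
    Finset.sum_pos (fun k _ => hω k) (by simp)
  refine propext ?_
  -- X(t_j) ≤ c_j for all j means that every point satisfies max_j Z^{(i)}(t_j)/c_j ≤ Γ_i: a void
  -- event for real marks.
  change (∀ j, deHaanField V W (t j) ω ≤ c j) ↔
    ∀ i, (maxRatio t c (W i ω) : ℝ) ≤ ∑ k ∈ Finset.range (i + 1), V k ω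
  simp only [deHaanField, iSup_le_iff]
  rw [forall_comm]
  refine forall_congr' fun i => ?_
  have hΓ' : 0 < (∑ k ∈ Finset.range (i + 1), V k ω).toNNReal := Real.toNNReal_pos.2 (hΓ i)
  rw [← Real.le_toNNReal_iff_coe_le (hΓ i).le, maxRatio, Finset.sup_le_iff]
  simp only [Finset.mem_univ, true_imp_iff]
  refine forall_congr' fun j => ?_
  rw [ENNReal.ofReal, ← ENNReal.coe_div hΓ'.ne', ENNReal.coe_le_coe, div_le_iff₀ hΓ',
    div_le_iff₀ (hc j), mul_comm]

/-- Stationarity equates the two distribution functions, and the finite exponents are recovered by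
injectivity of exp. -/
lemma lintegral_maxRatio_shift [IsProbabilityMeasure P] [IsProbabilityMeasure P₁]
    (hZ : IsSpectralField P Z)
    (hVW : IsDeHaanSample P Z P₁ V W) (hX : IsStationaryField P₁ (deHaanField V W))
    (h : Fin d → ℝ) {n : ℕ} (t : Fin n → Fin d → ℝ) (c : Fin n → ℝ≥0) (hc : ∀ j, 0 < c j) :
    ∫⁻ ω, (maxRatio (fun j => t j + h) c (Z ω) : ℝ≥0∞) ∂P
      = ∫⁻ ω, (maxRatio t c (Z ω) : ℝ≥0∞) ∂P := by
  have hs : MeasurableSet {y : Fin n → ℝ≥0∞ | ∀ j, y j ≤ c j} := by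
    have : {y : Fin n → ℝ≥0∞ | ∀ j, y j ≤ c j} = ⋂ j, {y : Fin n → ℝ≥0∞ | y j ≤ c j} := by
      ext; simp
    rw [this]
    exact MeasurableSet.iInter fun j => measurableSet_le (measurable_pi_apply _) measurable_const
  have h1 := (hX n t h).measure_mem_eq hs
  have h2 := measure_deHaanField_le hZ hVW (fun j => t j + h) c hc
  have h3 := measure_deHaanField_le hZ hVW t c hc
  have h4 := h2.symm.trans (h1.trans h3)
  rw [ENNReal.ofReal_eq_ofReal_iff (Real.exp_pos _).le (Real.exp_pos _).le, Real.exp_eq_exp,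
    neg_inj, ENNReal.toReal_eq_toReal_iff' (lintegral_maxRatio_ne_top hZ _ c)
      (lintegral_maxRatio_ne_top hZ _ c)] at h4
  exact h4

/-- The shift of a path. -/
def shiftPath (h : Fin d → ℝ) (f : (Fin d → ℝ) → ℝ≥0) : (Fin d → ℝ) → ℝ≥0 :=
  fun t => f (t + h)

lemma measurable_shiftPath (h : Fin d → ℝ) : Measurable (shiftPath h) :=
  measurable_pi_lambda _ fun _ => measurable_pi_apply _

/-- The exponent measure, restricted to the paths that exceed level one at the origin. -/
noncomputable def exceedanceLaw (P : Measure Ω) (Z : Ω → (Fin d → ℝ) → ℝ≥0) :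
    Measure ((Fin d → ℝ) → ℝ≥0) :=
  (exponentMeasure P Z).restrict {f | 1 < f 0}

lemma restrict_map_shiftPath [IsProbabilityMeasure P] [IsProbabilityMeasure P₁]
    (hZ : IsSpectralField P Z)
    (hVW : IsDeHaanSample P Z P₁ V W) (hX : IsStationaryField P₁ (deHaanField V W))
    (h : Fin d → ℝ) :
    ((exponentMeasure P Z).map (shiftPath h)).restrict {f | 1 < f 0} = exceedanceLaw P Z := by
  refine (restrict_one_lt_eq ?_ ?_ 0).symm
  · intro n t c hc
    rw [exponentMeasure_exists_lt hZ.measurable t c hc]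
    exact lintegral_maxRatio_ne_top hZ t c
  · intro n t c hc
    rw [Measure.map_apply (measurable_shiftPath h) (measurableSet_exists_lt t c),
      exponentMeasure_exists_lt hZ.measurable t c hc, ← lintegral_maxRatio_shift hZ hVW hX h t c hc,
      ← exponentMeasure_exists_lt hZ.measurable _ c hc]
    rfl

/-- The total mass is ν(f(0) > 1) = E Z(0) = 1. -/
lemma isProbabilityMeasure_exceedanceLaw [SFinite P] (hZ : IsSpectralField P Z) :
    IsProbabilityMeasure (exceedanceLaw P Z) := by
  refine ⟨?_⟩
  have h := exponentMeasure_exists_lt (P := P) hZ.measurable (fun _ : Fin 1 => 0) (fun _ => 1)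
    (fun _ => one_pos)
  simp only [maxRatio, div_one, Finset.univ_unique, Finset.sup_singleton, hZ.mean_one,
    exists_const] at h
  rw [exceedanceLaw, Measure.restrict_apply_univ, h]

end ExponentMeasure

/-! ### The law of Y = RΘ -/

section Pareto
variable {Ω Ω₂ : Type*} [MeasurableSpace Ω] [MeasurableSpace Ω₂] {P : Measure Ω} {P₂ : Measure Ω₂}
  {d : ℕ} {Z : Ω → (Fin d → ℝ) → ℝ≥0} {R : Ω₂ → ℝ} {Θ : Ω₂ → (Fin d → ℝ) → ℝ≥0}

/-- A measure with the survival function of the unit Pareto law is the law of `U⁻¹` with `U`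
uniform on `(0, 1)`. -/
lemma eq_map_inv_of_survival {ρ : Measure ℝ} [IsProbabilityMeasure ρ]
    (h : ∀ r : ℝ, 1 ≤ r → ρ (Set.Ioi r) = ENNReal.ofReal (1 / r)) :
    ρ = (volume.restrict (Set.Ioo (0 : ℝ) 1)).map (fun u => u⁻¹) := by
  set ρ' : Measure ℝ := (volume.restrict (Set.Ioo (0 : ℝ) 1)).map (fun u => u⁻¹) with hρ'
  have hu : IsProbabilityMeasure (volume.restrict (Set.Ioo (0 : ℝ) 1)) := ⟨by simp⟩
  have hp : IsProbabilityMeasure ρ' := Measure.isProbabilityMeasure_map measurable_inv.aemeasurable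
  have h' : ∀ r : ℝ, 1 ≤ r → ρ' (Set.Ioi r) = ENNReal.ofReal (1 / r) := by
    intro r hr
    have hr0 : 0 < r := one_pos.trans_le hr
    rw [hρ', Measure.map_apply measurable_inv measurableSet_Ioi,
      Measure.restrict_apply (measurable_inv measurableSet_Ioi)]
    have : (fun u : ℝ => u⁻¹) ⁻¹' Set.Ioi r ∩ Set.Ioo 0 1 = Set.Ioo 0 (1 / r) := by
      ext u
      change (r < u⁻¹) ∧ 0 < u ∧ u < 1 ↔ 0 < u ∧ u < 1 / r
      constructor
      · rintro ⟨h1, h2, -⟩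
        exact ⟨h2, by rw [one_div]; exact (lt_inv_comm₀ hr0 h2).1 h1⟩
      · rintro ⟨h1, h2⟩
        refine ⟨?_, h1, h2.trans_le ?_⟩
        · rw [one_div] at h2; exact (lt_inv_comm₀ hr0 h1).2 h2
        · rw [div_le_one hr0]; exact hr
    rw [this, Real.volume_Ioo, sub_zero]
  have hall : ∀ r, ρ (Set.Ioi r) = ρ' (Set.Ioi r) := by
    intro r
    rcases le_total 1 r with hr | hr
    · rw [h r hr, h' r hr]
    -- The mass beyond 1 is already full, so levels r ≤ 1 carry no further information.
    · have key : ∀ m : Measure ℝ, IsProbabilityMeasure m →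
          m (Set.Ioi 1) = ENNReal.ofReal (1 / 1) → m (Set.Ioi r) = 1 := by
        intro m _ hm
        refine le_antisymm prob_le_one ?_
        rw [div_one, ENNReal.ofReal_one] at hm
        rw [← hm]
        exact measure_mono (Set.Ioi_subset_Ioi hr)
      rw [key ρ inferInstance (h 1 le_rfl), key ρ' hp (h' 1 le_rfl)]
  refine Measure.ext_of_Iic _ _ fun r => ?_
  rw [← Set.compl_Ioi, prob_compl_eq_one_sub measurableSet_Ioi,
    prob_compl_eq_one_sub measurableSet_Ioi, hall]

/-- The path `r f`. -/
noncomputable def multPath (p : ℝ × ((Fin d → ℝ) → ℝ≥0)) : (Fin d → ℝ) → ℝ≥0 :=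
  fun t => p.1.toNNReal * p.2 t

lemma measurable_multPath : Measurable (multPath (d := d)) :=
  measurable_pi_lambda _ fun t => (measurable_real_toNNReal.comp measurable_fst).mul
    ((measurable_pi_apply t).comp measurable_snd)

/-- The law of `Y = R Θ` is the exponent measure restricted to the paths that exceed level one at
the origin. -/
lemma map_multPath_eq_exceedanceLaw [IsProbabilityMeasure P] [IsProbabilityMeasure P₂]
    (hZ : IsSpectralField P Z) (hRΘ : IsParetoTilted P Z P₂ R Θ) :
    P₂.map (fun ω => multPath (R ω, Θ ω)) = exceedanceLaw P Z := by
  have hR := hRΘ.measurable_R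
  have hΘ := hRΘ.measurable_Θ
  have hρp : IsProbabilityMeasure (P₂.map R) := Measure.isProbabilityMeasure_map hR.aemeasurable
  have hμp : IsProbabilityMeasure (P₂.map Θ) := Measure.isProbabilityMeasure_map hΘ.aemeasurable
  have hρ : P₂.map R = (volume.restrict (Set.Ioo (0 : ℝ) 1)).map (fun u => u⁻¹) := by
    refine eq_map_inv_of_survival fun r hr => ?_
    rw [Measure.map_apply hR measurableSet_Ioi]
    exact hRΘ.survival_R r hr
  have hnorm : Measurable (fun ω t => Z ω t / Z ω 0) :=
    measurable_pi_lambda _ fun t => (hZ.measurable t).div (hZ.measurable 0)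
  have hz0 : Measurable (fun ω => (Z ω 0 : ℝ≥0∞)) := (hZ.measurable 0).coe_nnreal_ennreal
  ext A hA
  have hA' : MeasurableSet (multPath ⁻¹' A) := measurable_multPath hA
  have hA0 : MeasurableSet (A ∩ {f : (Fin d → ℝ) → ℝ≥0 | 1 < f 0}) :=
    hA.inter (measurableSet_one_lt 0)
  have hY : Measurable (fun ω => multPath (R ω, Θ ω)) := measurable_multPath.comp (hR.prodMk hΘ)
  rw [Measure.map_apply hY hA]
  have e1 : P₂ ((fun ω => multPath (R ω, Θ ω)) ⁻¹' A)
      = P₂.map (fun ω => (R ω, Θ ω)) (multPath ⁻¹' A) := by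
    rw [Measure.map_apply (hR.prodMk hΘ) hA']; rfl
  have hsec : Measurable fun ω => P₂.map R
      ((fun r => (r, fun t => Z ω t / Z ω 0)) ⁻¹' (multPath ⁻¹' A)) :=
    (measurable_measure_prodMk_right hA').comp hnorm
  rw [e1, (indepFun_iff_map_prod_eq_prod_map_map hR.aemeasurable hΘ.aemeasurable).1 hRΘ.indep,
    Measure.prod_apply_symm hA', hRΘ.law_Θ, tiltedLaw,
    lintegral_map (measurable_measure_prodMk_right hA') hnorm,
    lintegral_withDensity_eq_lintegral_mul _ hz0 hsec,
    exceedanceLaw, Measure.restrict_apply hA, exponentMeasure,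
    Measure.map_apply (measurable_scaledPath hZ.measurable) hA0,
    Measure.prod_apply (measurable_scaledPath hZ.measurable hA0)]
  refine lintegral_congr fun ω => ?_
  rw [Pi.mul_apply, hρ, Measure.map_apply measurable_inv (measurable_prodMk_right hA'),
    Measure.restrict_apply (measurable_inv (measurable_prodMk_right hA')),
    Measure.restrict_apply (measurable_prodMk_left (measurable_scaledPath hZ.measurable hA0))]
  set S : Set ℝ := Prod.mk ω ⁻¹' (scaledPath Z ⁻¹' (A ∩ {f | 1 < f 0})) ∩ Set.Ioi 0 with hS
  have hSmem : ∀ s, s ∈ S ↔ scaledPath Z (ω, s) ∈ A ∧ 1 < Z ω 0 / s.toNNReal ∧ 0 < s := by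
    intro s
    rw [← and_assoc]; rfl
  rcases eq_or_lt_of_le (zero_le : 0 ≤ Z ω 0) with h0 | h0
  -- Where Z(0) = 0 the tilting weight vanishes, and no Z/s exceeds 1 at the origin, so both sides
  -- are zero.
  · have : S = ∅ := by
      refine Set.eq_empty_of_forall_notMem fun s hs => ?_
      have := ((hSmem s).1 hs).2.1
      rw [← h0, zero_div] at this
      exact not_lt.2 zero_le this
    rw [this, ← h0]
    simp
  · have hz : (0 : ℝ) < Z ω 0 := h0
    -- Substituting s = Z(0) u turns u⁻¹ · Z/Z(0) into Z/s and u < 1 into Z(0)/s > 1; the Jacobian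
    -- cancels the tilting weight Z(0).
    have hpre : (fun u : ℝ => u⁻¹) ⁻¹' ((fun r => (r, fun t => Z ω t / Z ω 0)) ⁻¹' (multPath ⁻¹' A))
        ∩ Set.Ioo 0 1 = (fun u => (Z ω 0 : ℝ) * u) ⁻¹' S := by
      ext u
      rw [Set.mem_preimage (f := fun u => (Z ω 0 : ℝ) * u), hSmem]
      change multPath (u⁻¹, fun t => Z ω t / Z ω 0) ∈ A ∧ 0 < u ∧ u < 1 ↔ _
      rw [mul_pos_iff_of_pos_left hz]
      suffices h : 0 < u → ((multPath (u⁻¹, fun t => Z ω t / Z ω 0) ∈ A ∧ u < 1) ↔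
          (scaledPath Z (ω, (Z ω 0 : ℝ) * u) ∈ A ∧ 1 < Z ω 0 / ((Z ω 0 : ℝ) * u).toNNReal)) by
        tauto
      intro hu
      have hu' : 0 < u.toNNReal := Real.toNNReal_pos.2 hu
      have htn : ((Z ω 0 : ℝ) * u).toNNReal = Z ω 0 * u.toNNReal := by
        rw [Real.toNNReal_mul hz.le, Real.toNNReal_coe]
      have hp : multPath (u⁻¹, fun t => Z ω t / Z ω 0) = scaledPath Z (ω, (Z ω 0 : ℝ) * u) := by
        funext t
        simp only [multPath, scaledPath, htn, Real.toNNReal_inv]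
        rw [div_mul_eq_div_div, mul_comm, ← div_eq_mul_inv]
      rw [hp, htn, lt_div_iff₀ (mul_pos h0 hu'), one_mul, mul_lt_iff_lt_one_right h0,
        Real.toNNReal_lt_one]
    change (Z ω 0 : ℝ≥0∞) * volume (((fun u : ℝ => u⁻¹) ⁻¹'
      ((fun r => (r, fun t => Z ω t / Z ω 0)) ⁻¹' (multPath ⁻¹' A))) ∩ Set.Ioo 0 1) = _
    rw [hpre, Real.volume_preimage_mul_left hz.ne', ← mul_assoc, abs_of_pos (inv_pos.2 hz),
      ENNReal.ofReal_inv_of_pos hz, ENNReal.ofReal_coe_nnreal,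
      ENNReal.mul_inv_cancel (by exact_mod_cast h0.ne') ENNReal.coe_ne_top, one_mul]

lemma IsParetoTilted.sojournY_ae_eq (hRΘ : IsParetoTilted P Z P₂ R Θ) (δ : ℝ) :
    ∀ᵐ ω ∂P₂, sojournY δ R Θ ω = regSojourn δ Set.univ (multPath (R ω, Θ ω)) := by
  filter_upwards [hRΘ.cadlag_Θ] with ω hω
  have hc : IsCadlag (multPath (R ω, Θ ω)) := hω.comp_mul _
  rw [hc.regSojourn_eq, sojournY, sojourn]
  congr 2
  ext t
  change 1 < R ω * (Θ ω t : ℝ) ↔ 1 < (R ω).toNNReal * Θ ω t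
  rcases le_total 0 (R ω) with h | h
  · rw [← NNReal.coe_lt_coe, NNReal.coe_mul, Real.coe_toNNReal _ h, NNReal.coe_one]
  · rw [Real.toNNReal_of_nonpos h, zero_mul]
    refine iff_of_false (not_lt.2 ?_) (not_lt.2 zero_le_one)
    exact (mul_nonpos_of_nonpos_of_nonneg h (NNReal.coe_nonneg _)).trans zero_le_one

end Pareto

/-! ### The limit formula for the Berman function and the second moment bound -/

section Berman
variable {Ω : Type*} [MeasurableSpace Ω] {P : Measure Ω} {d : ℕ} {Z : Ω → (Fin d → ℝ) → ℝ≥0}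

/-- The function `y ↦ 1{y > x} / y`. -/
noncomputable def truncInv (x y : ℝ≥0∞) : ℝ≥0∞ := (Set.Ioi x).indicator (fun y => y⁻¹) y

lemma measurable_truncInv (x : ℝ≥0∞) : Measurable (truncInv x) :=
  measurable_inv.indicator measurableSet_Ioi

lemma truncInv_le (x y : ℝ≥0∞) : truncInv x y ≤ x⁻¹ :=
  Set.indicator_apply_le' (fun h => ENNReal.inv_le_inv.2 (le_of_lt h)) fun _ => zero_le

omit [MeasurableSpace Ω] in
lemma IsCadlag.scaledPath {ω : Ω} (h : IsCadlag (Z ω)) (s : ℝ) : IsCadlag (scaledPath Z (ω, s)) := by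
  have e : _root_.scaledPath Z (ω, s) = fun t => (s.toNNReal)⁻¹ * Z ω t := by
    funext t
    rw [_root_.scaledPath, div_eq_inv_mul]
  rw [e]
  exact h.comp_mul _

lemma ae_isCadlag_scaledPath [SFinite P] (hZ : IsSpectralField P Z) :
    ∀ᵐ p ∂(P.prod (volume.restrict (Set.Ioi (0 : ℝ)))), IsCadlag (scaledPath Z p) := by
  have h := Measure.quasiMeasurePreserving_fst (μ := P)
    (ν := volume.restrict (Set.Ioi (0 : ℝ))) |>.ae hZ.cadlag
  filter_upwards [h] with p hp
  exact hp.scaledPath p.2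

lemma bermanPre_eq_exponentMeasure [SFinite P] (hZ : IsSpectralField P Z) (δ T x : ℝ) :
    bermanPre P Z δ T x
      = exponentMeasure P Z {f | ENNReal.ofReal x < regSojourn δ (cube d T) f} := by
  have hm := measurable_scaledPath hZ.measurable
  have hs : MeasurableSet {f | ENNReal.ofReal x < regSojourn δ (cube d T) f} :=
    measurableSet_lt measurable_const (measurable_regSojourn δ measurableSet_Icc)
  rw [exponentMeasure, Measure.map_apply hm hs, Measure.prod_apply_symm (hm hs), bermanPre]
  refine setLIntegral_congr_fun measurableSet_Ioi fun s hs => ?_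
  have hs0 : 0 < s := hs
  refine measure_congr ?_
  filter_upwards [hZ.cadlag] with ω hω
  have hc : IsCadlag (scaledPath Z (ω, s)) := hω.scaledPath s
  refine propext ?_
  change ENNReal.ofReal x < sojourn δ (cube d T) (fun t => (Z ω t : ℝ)) s ↔
    ENNReal.ofReal x < regSojourn δ (cube d T) (scaledPath Z (ω, s))
  rw [hc.regSojourn_eq, sojourn]
  have : {t | s < (Z ω t : ℝ)} = {t | 1 < scaledPath Z (ω, s) t} := by
    ext t
    change s < (Z ω t : ℝ) ↔ 1 < Z ω t / s.toNNReal
    rw [lt_div_iff₀ (Real.toNNReal_pos.2 hs0), one_mul, Real.toNNReal_lt_iff_lt_coe hs0.le]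
  rw [this]

/-- Regularisation along a fixed grid does not commute with shifts, so the càdlàg property is needed
to pass to the path itself. -/
lemma IsCadlag.regSojourn_shiftPath {f : (Fin d → ℝ) → ℝ≥0} (hf : IsCadlag f) {δ : ℝ}
    {t : Fin d → ℝ}
    (ht : MeasurePreserving (fun u => u + t) (gridMeasure d δ) (gridMeasure d δ))
    (A : Set (Fin d → ℝ)) :
    regSojourn δ ((fun u => u + t) ⁻¹' A) (shiftPath t f) = regSojourn δ A f := by
  rw [hf.regSojourn_eq, (show IsCadlag (shiftPath t f) from hf.comp_add t).regSojourn_eq,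
    ← ht.measure_preimage_emb (measurableEmbedding_addRight t) (A ∩ {t | 1 < f t})]
  rfl

variable {Ω₁ : Type*} [MeasurableSpace Ω₁] {P₁ : Measure Ω₁}
  {V : ℕ → Ω₁ → ℝ} {W : ℕ → Ω₁ → (Fin d → ℝ) → ℝ≥0}

lemma lintegral_exceedanceLaw_eq_shift [IsProbabilityMeasure P] [IsProbabilityMeasure P₁]
    (hZ : IsSpectralField P Z)
    (hVW : IsDeHaanSample P Z P₁ V W) (hX : IsStationaryField P₁ (deHaanField V W))
    (t : Fin d → ℝ) {G : ((Fin d → ℝ) → ℝ≥0) → ℝ≥0∞} (hG : Measurable G) :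
    ∫⁻ f, G f ∂(exceedanceLaw P Z)
      = ∫⁻ p, {f : (Fin d → ℝ) → ℝ≥0 | 1 < f 0}.indicator G (shiftPath t (scaledPath Z p))
        ∂(P.prod (volume.restrict (Set.Ioi (0 : ℝ)))) := by
  have hm := measurable_scaledPath hZ.measurable
  have hGm := hG.indicator (measurableSet_one_lt (0 : Fin d → ℝ))
  have hGs : Measurable fun f =>
      {f : (Fin d → ℝ) → ℝ≥0 | 1 < f 0}.indicator G (shiftPath t f) :=
    hGm.comp (measurable_shiftPath t)
  rw [← restrict_map_shiftPath hZ hVW hX t, ← lintegral_indicator (measurableSet_one_lt 0),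
    lintegral_map hGm (measurable_shiftPath t), exponentMeasure]
  exact lintegral_map hGs hm

/-- The shift identity behind the Berman function. -/
lemma lintegral_exponentMeasure_shift [IsProbabilityMeasure P] [IsProbabilityMeasure P₁]
    (hZ : IsSpectralField P Z)
    (hVW : IsDeHaanSample P Z P₁ V W) (hX : IsStationaryField P₁ (deHaanField V W))
    {δ : ℝ} {t : Fin d → ℝ}
    (ht : MeasurePreserving (fun u => u + t) (gridMeasure d δ) (gridMeasure d δ))
    {A : Set (Fin d → ℝ)} (hA : MeasurableSet A) {h : ℝ≥0∞ → ℝ≥0∞} (hh : Measurable h) :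
    ∫⁻ f, {t | 1 < regPath f t}.indicator (fun _ => h (regSojourn δ A f)) t ∂(exponentMeasure P Z)
      = ∫⁻ f, h (regSojourn δ ((fun u => u + t) ⁻¹' A) f) ∂(exceedanceLaw P Z) := by
  have hA' : MeasurableSet ((fun u => u + t) ⁻¹' A) := ht.measurable hA
  have hreg : Measurable fun f : (Fin d → ℝ) → ℝ≥0 => regPath f t :=
    measurable_regPath.of_uncurry_right
  have hFm : Measurable fun f : (Fin d → ℝ) → ℝ≥0 =>
      {t | 1 < regPath f t}.indicator (fun _ => h (regSojourn δ A f)) t :=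
    Measurable.indicator (s := {f | 1 < regPath f t}) (hh.comp (measurable_regSojourn δ hA))
      (measurableSet_lt measurable_const hreg)
  have hGm : Measurable fun f => h (regSojourn δ ((fun u => u + t) ⁻¹' A) f) :=
    hh.comp (measurable_regSojourn δ hA')
  rw [lintegral_exceedanceLaw_eq_shift hZ hVW hX t hGm, exponentMeasure,
    lintegral_map hFm (measurable_scaledPath hZ.measurable)]
  refine lintegral_congr_ae ?_
  filter_upwards [ae_isCadlag_scaledPath hZ] with p hp
  generalize scaledPath Z p = f at hp ⊢
  have h1 : (1 < regPath f t) ↔ 1 < shiftPath t f 0 := by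
    rw [hp.regPath_eq, shiftPath, zero_add, ← ENNReal.coe_one, ENNReal.coe_lt_coe]
  by_cases h2 : 1 < shiftPath t f 0
  · have h3 : t ∈ {t | 1 < regPath f t} := h1.2 h2
    have h4 : shiftPath t f ∈ {f : (Fin d → ℝ) → ℝ≥0 | 1 < f 0} := h2
    rw [Set.indicator_of_mem h3, Set.indicator_of_mem h4, hp.regSojourn_shiftPath ht]
  · have h3 : t ∉ {t | 1 < regPath f t} := fun h => h2 (h1.1 h)
    have h4 : shiftPath t f ∉ {f : (Fin d → ℝ) → ℝ≥0 | 1 < f 0} := h2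
    rw [Set.indicator_of_notMem h3, Set.indicator_of_notMem h4]

lemma bermanPre_eq_lintegral [IsProbabilityMeasure P] [IsProbabilityMeasure P₁]
    (hZ : IsSpectralField P Z)
    (hVW : IsDeHaanSample P Z P₁ V W) (hX : IsStationaryField P₁ (deHaanField V W))
    (δ : ℝ) {T : ℝ} (hT : gridMeasure d δ (cube d T) ≠ ∞) (x : ℝ) :
    bermanPre P Z δ T x = ∫⁻ t in cube d T, ∫⁻ f, truncInv (ENNReal.ofReal x)
      (regSojourn δ ((fun u => u + t) ⁻¹' cube d T) f) ∂(exceedanceLaw P Z) ∂(gridMeasure d δ) := by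
  have hcube : MeasurableSet (cube d T) := measurableSet_Icc
  have hS := measurable_regSojourn δ hcube
  have hs : MeasurableSet {f | ENNReal.ofReal x < regSojourn δ (cube d T) f} :=
    measurableSet_lt measurable_const hS
  have hset : MeasurableSet {p : ((Fin d → ℝ) → ℝ≥0) × (Fin d → ℝ) | 1 < regPath p.1 p.2} :=
    measurableSet_lt measurable_const measurable_regPath
  have hfibre : ∀ f : (Fin d → ℝ) → ℝ≥0, MeasurableSet {t | 1 < regPath f t} :=
    fun f => measurable_prodMk_left hset
  rw [bermanPre_eq_exponentMeasure hZ, ← lintegral_indicator_one hs]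
  -- The inner integral is truncInv(S) · S with S the sojourn in the cube. This equals 1{S > x}
  -- because S > x implies S ≠ 0 and `hT` gives S < ∞.
  have h1 : ∀ f, {f | ENNReal.ofReal x < regSojourn δ (cube d T) f}.indicator 1 f
      = ∫⁻ t in cube d T, {t | 1 < regPath f t}.indicator
        (fun _ => truncInv (ENNReal.ofReal x) (regSojourn δ (cube d T) f)) t
          ∂(gridMeasure d δ) := by
    intro f
    rw [lintegral_indicator_const (hfibre f), Measure.restrict_apply (hfibre f), Set.inter_comm]
    change _ = _ * regSojourn δ (cube d T) f
    by_cases hf : ENNReal.ofReal x < regSojourn δ (cube d T) f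
    · rw [Set.indicator_of_mem (show f ∈ {f | _ < regSojourn δ (cube d T) f} from hf), truncInv,
        Set.indicator_of_mem (Set.mem_Ioi.2 hf), ENNReal.inv_mul_cancel]
      · rfl
      · exact (zero_le.trans_lt hf).ne'
      · exact ((measure_mono Set.inter_subset_left).trans_lt (lt_top_iff_ne_top.2 hT)).ne
    · rw [Set.indicator_of_notMem (show f ∉ {f | _ < regSojourn δ (cube d T) f} from hf), truncInv,
        Set.indicator_of_notMem (by simpa using hf), zero_mul]
  simp_rw [h1]
  rw [lintegral_lintegral_swap]
  · refine lintegral_congr_ae ?_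
    -- Shift invariance of λ_δ is available only for λ_δ-almost all t, in effect for lattice points
    -- when δ > 0.
    filter_upwards [ae_restrict_of_ae (ae_measurePreserving_gridMeasure (d := d) δ)] with t ht
    exact lintegral_exponentMeasure_shift hZ hVW hX ht hcube (measurable_truncInv _)
  · refine Measurable.aemeasurable ?_
    exact Measurable.indicator
      (s := {p : ((Fin d → ℝ) → ℝ≥0) × (Fin d → ℝ) | 1 < regPath p.1 p.2})
      (((measurable_truncInv _).comp hS).comp measurable_fst) hset

/-- The box `[-n, n]^d`. -/
def centredBox (d n : ℕ) : Set (Fin d → ℝ) := Set.Icc (fun _ => -(n : ℝ)) (fun _ => n)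

lemma monotone_centredBox (d : ℕ) : Monotone (centredBox d) := by
  intro m n hmn
  have : (m : ℝ) ≤ n := by exact_mod_cast hmn
  exact Set.Icc_subset_Icc (fun _ => by simpa using this) (fun _ => this)

lemma iUnion_centredBox (d : ℕ) : ⋃ n, centredBox d n = Set.univ := by
  refine Set.eq_univ_of_forall fun t => ?_
  obtain ⟨n, hn⟩ := exists_nat_ge (∑ i, |t i|)
  refine Set.mem_iUnion.2 ⟨n, ?_⟩
  have h : ∀ i, |t i| ≤ n := fun i =>
    (Finset.single_le_sum (f := fun i => |t i|) (fun _ _ => abs_nonneg _) (Finset.mem_univ i)).trans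
      hn
  exact ⟨fun i => (abs_le.1 (h i)).1, fun i => (abs_le.1 (h i)).2⟩

lemma tendsto_regSojourn_centredBox (δ : ℝ) (f : (Fin d → ℝ) → ℝ≥0) :
    Tendsto (fun n => regSojourn δ (centredBox d n) f) atTop (𝓝 (regSojourn δ Set.univ f)) := by
  have h := tendsto_measure_iUnion_atTop (μ := gridMeasure d δ)
    (s := fun n => centredBox d n ∩ {t | 1 < regPath f t})
    (fun m n hmn => Set.inter_subset_inter_left _ (monotone_centredBox d hmn))
  rw [← Set.iUnion_inter, iUnion_centredBox] at h
  exact h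

lemma regSojourn_mono (δ : ℝ) {A B : Set (Fin d → ℝ)} (h : A ⊆ B) (f : (Fin d → ℝ) → ℝ≥0) :
    regSojourn δ A f ≤ regSojourn δ B f :=
  measure_mono (Set.inter_subset_inter_left _ h)

/-- The lower bound for `1{y > x} / y` when `l ≤ y ≤ u`. -/
noncomputable def truncInvLower (x l u : ℝ≥0∞) : ℝ≥0∞ := if x < l then u⁻¹ else 0

/-- The upper bound for `1{y > x} / y` when `l ≤ y ≤ u`. -/
noncomputable def truncInvUpper (x l u : ℝ≥0∞) : ℝ≥0∞ := if x < u then (max l x)⁻¹ else 0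

lemma truncInvLower_le {x l y u : ℝ≥0∞} (h1 : l ≤ y) (h2 : y ≤ u) :
    truncInvLower x l u ≤ truncInv x y := by
  unfold truncInvLower
  split_ifs with h
  · rw [truncInv, Set.indicator_of_mem (Set.mem_Ioi.2 (h.trans_le h1))]
    exact ENNReal.inv_le_inv.2 h2
  · exact zero_le

lemma le_truncInvUpper {x l y u : ℝ≥0∞} (h1 : l ≤ y) (h2 : y ≤ u) :
    truncInv x y ≤ truncInvUpper x l u := by
  refine Set.indicator_apply_le' (fun h => ?_) fun _ => zero_le
  have h : x < y := h
  rw [truncInvUpper, if_pos (h.trans_le h2)]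
  exact ENNReal.inv_le_inv.2 (max_le h1 h.le)

lemma truncInvUpper_le (x l u : ℝ≥0∞) : truncInvUpper x l u ≤ x⁻¹ := by
  unfold truncInvUpper
  split_ifs
  · exact ENNReal.inv_le_inv.2 (le_max_right _ _)
  · exact zero_le

/-- The jump at x is harmless because `l` approaches `u` from below: x < u forces x < l n
eventually, and u ≤ x excludes x < l n for every n. -/
lemma tendsto_truncInvLower {x u : ℝ≥0∞} {l : ℕ → ℝ≥0∞} (hl : Tendsto l atTop (𝓝 u))
    (hlu : ∀ n, l n ≤ u) : Tendsto (fun n => truncInvLower x (l n) u) atTop (𝓝 (truncInv x u)) := by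
  by_cases h : x < u
  · rw [truncInv, Set.indicator_of_mem (Set.mem_Ioi.2 h)]
    refine tendsto_const_nhds.congr' ?_
    filter_upwards [hl.eventually (lt_mem_nhds h)] with n hn
    rw [truncInvLower, if_pos hn]
  · rw [truncInv, Set.indicator_of_notMem (by simpa using h)]
    refine tendsto_const_nhds.congr fun n => ?_
    rw [truncInvLower, if_neg fun hn => h (hn.trans_le (hlu n))]

lemma tendsto_truncInvUpper {x u : ℝ≥0∞} {l : ℕ → ℝ≥0∞} (hl : Tendsto l atTop (𝓝 u)) :
    Tendsto (fun n => truncInvUpper x (l n) u) atTop (𝓝 (truncInv x u)) := by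
  by_cases h : x < u
  · rw [truncInv, Set.indicator_of_mem (Set.mem_Ioi.2 h)]
    simp only [truncInvUpper, if_pos h]
    have := (hl.max (tendsto_const_nhds (x := x))).inv
    rwa [max_eq_left h.le] at this
  · rw [truncInv, Set.indicator_of_notMem (by simpa using h)]
    simp only [truncInvUpper, if_neg h]
    exact tendsto_const_nhds

/-- The value `E[1{ε > x} / ε]` of the Berman function. -/
noncomputable def bermanValue (P : Measure Ω) (Z : Ω → (Fin d → ℝ) → ℝ≥0) (δ x : ℝ) : ℝ≥0∞ :=
  ∫⁻ f, truncInv (ENNReal.ofReal x) (regSojourn δ Set.univ f) ∂(exceedanceLaw P Z)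

/-- The form needed for an iterated limit: T → ∞ for fixed n, then n → ∞ in the bounds. -/
lemma tendsto_of_forall_sandwich {ι : Type*} {L : Filter ι} {F : ι → ℝ≥0∞}
    {l u : ℕ → ι → ℝ≥0∞} {a b : ℕ → ℝ≥0∞} {B : ℝ≥0∞}
    (hl : ∀ n, ∀ᶠ i in L, l n i ≤ F i) (hu : ∀ n, ∀ᶠ i in L, F i ≤ u n i)
    (hla : ∀ n, Tendsto (l n) L (𝓝 (a n))) (hub : ∀ n, Tendsto (u n) L (𝓝 (b n)))
    (ha : Tendsto a atTop (𝓝 B)) (hb : Tendsto b atTop (𝓝 B)) : Tendsto F L (𝓝 B) := by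
  rw [tendsto_order]
  constructor
  · intro c hc
    obtain ⟨n, hn⟩ := (ha.eventually (lt_mem_nhds hc)).exists
    filter_upwards [hl n, (hla n).eventually (lt_mem_nhds hn)] with i h1 h2
    exact h2.trans_le h1
  · intro c hc
    obtain ⟨n, hn⟩ := (hb.eventually (gt_mem_nhds hc)).exists
    filter_upwards [hu n, (hub n).eventually (gt_mem_nhds hn)] with i h1 h2
    exact h1.trans_lt h2

/-- The cube `[n, T - n]^d`. -/
def innerCube (d n : ℕ) (T : ℝ) : Set (Fin d → ℝ) := Set.Icc (fun _ => (n : ℝ)) (fun _ => T - n)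

lemma innerCube_subset (d n : ℕ) (T : ℝ) : innerCube d n T ⊆ cube d T :=
  Set.Icc_subset_Icc (fun _ => Nat.cast_nonneg n) (fun _ => by simp)

lemma centredBox_subset {n : ℕ} {T : ℝ} {t : Fin d → ℝ} (ht : t ∈ innerCube d n T) :
    centredBox d n ⊆ (fun u => u + t) ⁻¹' cube d T := by
  intro u hu
  refine ⟨fun i => ?_, fun i => ?_⟩
  · have := ht.1 i; have := hu.1 i; simp only [Pi.zero_apply, Pi.add_apply]; linarith
  · have := ht.2 i; have := hu.2 i; simp only [Pi.add_apply]; linarith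

lemma tendsto_gridMeasure_innerCube {δ : ℝ} (hδ : 0 ≤ δ) (n : ℕ) :
    Tendsto (fun T : ℝ => gridMeasure d δ (innerCube d n T) / ENNReal.ofReal (T ^ d)) atTop
      (𝓝 1) :=
  tendsto_gridMeasure_Icc_div hδ n

lemma eventually_gridMeasure_innerCube {δ : ℝ} (hδ : 0 ≤ δ) (n : ℕ) :
    ∀ᶠ T : ℝ in atTop, gridMeasure d δ (innerCube d n T) ≠ ∞ := by
  obtain ⟨g, hg, -⟩ := gridMeasure_Icc_eventually (d := d) hδ n
  filter_upwards [hg] with T hT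
  rw [innerCube, hT]
  exact ENNReal.ofReal_ne_top

lemma innerCube_zero (d : ℕ) (T : ℝ) : innerCube d 0 T = cube d T := by
  simp only [innerCube, cube, Nat.cast_zero, sub_zero]; rfl

/-- The boundary layer of fixed width n is negligible against T^d. -/
lemma tendsto_gridMeasure_diff {δ : ℝ} (hδ : 0 ≤ δ) (n : ℕ) :
    Tendsto (fun T : ℝ => gridMeasure d δ (cube d T \ innerCube d n T) / ENNReal.ofReal (T ^ d))
      atTop (𝓝 0) := by
  have h0 := tendsto_gridMeasure_innerCube (d := d) hδ 0
  have h1 := ENNReal.Tendsto.sub h0 (tendsto_gridMeasure_innerCube (d := d) hδ n)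
    (Or.inl ENNReal.one_ne_top)
  rw [tsub_self] at h1
  refine h1.congr' ?_
  filter_upwards [eventually_gridMeasure_innerCube (d := d) hδ n, eventually_gt_atTop 0]
    with T hT hT0
  rw [innerCube_zero, measure_sdiff (innerCube_subset d n T) measurableSet_Icc.nullMeasurableSet hT,
    ENNReal.sub_div fun _ _ => (ENNReal.ofReal_pos.2 (pow_pos hT0 d)).ne']

lemma tendsto_bermanPre_div [IsProbabilityMeasure P] [IsProbabilityMeasure P₁]
    (hZ : IsSpectralField P Z)
    (hVW : IsDeHaanSample P Z P₁ V W) (hX : IsStationaryField P₁ (deHaanField V W))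
    {δ : ℝ} (hδ : 0 ≤ δ) {x : ℝ} (hx : 0 < x) :
    Tendsto (fun T : ℝ => bermanPre P Z δ T x / ENNReal.ofReal (T ^ d)) atTop
      (𝓝 (bermanValue P Z δ x)) := by
  have hQ : IsProbabilityMeasure (exceedanceLaw P Z) := isProbabilityMeasure_exceedanceLaw hZ
  set Q := exceedanceLaw P Z with hQdef
  set y : ℝ≥0∞ := ENNReal.ofReal x with hy
  have hy0 : y ≠ 0 := (ENNReal.ofReal_pos.2 hx).ne'
  have hyi : y⁻¹ ≠ ∞ := ENNReal.inv_ne_top.2 hy0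
  have hU := measurable_regSojourn (d := d) δ MeasurableSet.univ
  have hN : ∀ n, Measurable (regSojourn δ (centredBox d n)) := fun n =>
    measurable_regSojourn δ measurableSet_Icc
  set a : ℕ → ℝ≥0∞ := fun n =>
    ∫⁻ f, truncInvLower y (regSojourn δ (centredBox d n) f) (regSojourn δ Set.univ f) ∂Q
  set b : ℕ → ℝ≥0∞ := fun n =>
    ∫⁻ f, truncInvUpper y (regSojourn δ (centredBox d n) f) (regSojourn δ Set.univ f) ∂Q
  have hle : ∀ n f, regSojourn δ (centredBox d n) f ≤ regSojourn δ Set.univ f := fun n f =>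
    regSojourn_mono δ (Set.subset_univ _) f
  have ha : Tendsto a atTop (𝓝 (bermanValue P Z δ x)) := by
    refine tendsto_lintegral_of_dominated_convergence (fun _ => y⁻¹) ?_ ?_ (by simpa using hy0) ?_
    · intro n
      exact Measurable.ite (measurableSet_lt measurable_const (hN n)) hU.inv measurable_const
    · exact fun n => ae_of_all _ fun f =>
        (truncInvLower_le (hle n f) le_rfl).trans (truncInv_le _ _)
    · exact ae_of_all _ fun f =>
        tendsto_truncInvLower (tendsto_regSojourn_centredBox δ f) fun n => hle n f
  have hb : Tendsto b atTop (𝓝 (bermanValue P Z δ x)) := by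
    refine tendsto_lintegral_of_dominated_convergence (fun _ => y⁻¹) ?_ ?_ (by simpa using hy0) ?_
    · intro n
      exact Measurable.ite (measurableSet_lt measurable_const hU)
        ((hN n).max measurable_const).inv measurable_const
    · exact fun n => ae_of_all _ fun f => truncInvUpper_le _ _ _
    · exact ae_of_all _ fun f => tendsto_truncInvUpper (tendsto_regSojourn_centredBox δ f)
  -- For t in the inner cube, the sojourn lies between those over [-n,n]^d and over the whole space.
  -- On the boundary layer the integrand is bounded by x⁻¹ for the upper estimate and dropped for
  -- the lower one.
  refine tendsto_of_forall_sandwich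
    (l := fun n T => gridMeasure d δ (innerCube d n T) / ENNReal.ofReal (T ^ d) * a n)
    (u := fun n T => gridMeasure d δ (innerCube d n T) / ENNReal.ofReal (T ^ d) * b n
      + gridMeasure d δ (cube d T \ innerCube d n T) / ENNReal.ofReal (T ^ d) * y⁻¹)
    (a := a) (b := b) ?_ ?_ ?_ ?_ ha hb
  · intro n
    filter_upwards [eventually_gridMeasure_innerCube (d := d) hδ 0] with T hT
    rw [innerCube_zero] at hT
    rw [bermanPre_eq_lintegral hZ hVW hX δ hT, ENNReal.mul_div_right_comm.symm]
    refine ENNReal.div_le_div_right ?_ _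
    refine le_trans ?_ (lintegral_mono_set (innerCube_subset d n T))
    rw [mul_comm, ← setLIntegral_const]
    refine setLIntegral_mono' measurableSet_Icc fun t ht => ?_
    refine lintegral_mono fun f => ?_
    exact truncInvLower_le (regSojourn_mono δ (centredBox_subset ht) f)
      (regSojourn_mono δ (Set.subset_univ _) f)
  · intro n
    filter_upwards [eventually_gridMeasure_innerCube (d := d) hδ 0] with T hT
    rw [innerCube_zero] at hT
    rw [bermanPre_eq_lintegral hZ hVW hX δ hT, ENNReal.mul_div_right_comm.symm,
      ENNReal.mul_div_right_comm.symm, ← ENNReal.add_div]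
    refine ENNReal.div_le_div_right ?_ _
    rw [← lintegral_inter_add_sdiff _ (cube d T) (B := innerCube d n T) measurableSet_Icc,
      Set.inter_eq_self_of_subset_right (innerCube_subset d n T)]
    refine add_le_add ?_ ?_
    · rw [mul_comm, ← setLIntegral_const]
      refine setLIntegral_mono' measurableSet_Icc fun t ht => ?_
      refine lintegral_mono fun f => ?_
      exact le_truncInvUpper (regSojourn_mono δ (centredBox_subset ht) f)
        (regSojourn_mono δ (Set.subset_univ _) f)
    · rw [mul_comm, ← setLIntegral_const]
      refine lintegral_mono fun t => ?_
      refine (lintegral_mono fun f => truncInv_le y _).trans ?_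
      simp
  · intro n
    have := ENNReal.Tendsto.mul_const (b := a n) (tendsto_gridMeasure_innerCube (d := d) hδ n)
      (Or.inl one_ne_zero)
    rwa [one_mul] at this
  · intro n
    have h1 := ENNReal.Tendsto.mul_const (b := b n) (tendsto_gridMeasure_innerCube (d := d) hδ n)
      (Or.inl one_ne_zero)
    have h2 := ENNReal.Tendsto.mul_const (b := y⁻¹) (tendsto_gridMeasure_diff (d := d) hδ n)
      (Or.inr hyi)
    have := h1.add h2
    rwa [one_mul, zero_mul, add_zero] at this

/-- A second moment bound: `Q(S > x)² ≤ E[S] E[1{S > x} / S]`. -/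
lemma sq_measure_lt_le {α : Type*} [MeasurableSpace α] {Q : Measure α} {S : α → ℝ≥0∞}
    (hS : Measurable S) (hfin : ∫⁻ f, S f ∂Q ≠ ∞) (y : ℝ≥0∞) :
    Q {f | y < S f} ^ 2 ≤ (∫⁻ f, truncInv y (S f) ∂Q) * ∫⁻ f, S f ∂Q := by
  have hT := (measurable_truncInv y).comp hS
  have hCS := ENNReal.lintegral_mul_le_Lp_mul_Lq Q Real.HolderConjugate.two_two
    (f := fun f => truncInv y (S f) ^ (1 / 2 : ℝ)) (g := fun f => S f ^ (1 / 2 : ℝ))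
    (hT.pow_const _).aemeasurable (hS.pow_const _).aemeasurable
  simp only [← ENNReal.rpow_mul, Pi.mul_apply] at hCS
  norm_num at hCS
  have hlow : Q {f | y < S f} ≤ ∫⁻ f, truncInv y (S f) ^ (1 / 2 : ℝ) * S f ^ (1 / 2 : ℝ) ∂Q := by
    rw [← lintegral_indicator_one (measurableSet_lt measurable_const hS)]
    refine lintegral_mono_ae ?_
    -- A finite mean makes S finite almost everywhere, so that S⁻¹ · S = 1 on {S > y}; at S = ∞ the
    -- product would be 0.
    filter_upwards [ae_lt_top hS hfin] with f hf
    refine Set.indicator_apply_le' (fun h => ?_) fun _ => zero_le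
    have h : y < S f := h
    rw [truncInv, Set.indicator_of_mem (Set.mem_Ioi.2 h),
      ← ENNReal.mul_rpow_of_nonneg _ _ (by norm_num),
      ENNReal.inv_mul_cancel (zero_le.trans_lt h).ne' hf.ne, ENNReal.one_rpow]
    rfl
  have h := pow_le_pow_left' (hlow.trans hCS) 2
  rw [← ENNReal.mul_rpow_of_nonneg _ _ (by norm_num), ← ENNReal.rpow_natCast _ 2,
    ← ENNReal.rpow_natCast _ 2, ← ENNReal.rpow_mul] at h
  norm_num at h
  exact h

end Berman

/-! ### Transfer to Y and the two bounds -/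

theorem mainTheorem7 {Ω Ω₁ Ω₂ : Type*}
    [MeasurableSpace Ω] [MeasurableSpace Ω₁] [MeasurableSpace Ω₂]
    (P : Measure Ω) [IsProbabilityMeasure P]
    (P₁ : Measure Ω₁) [IsProbabilityMeasure P₁]
    (P₂ : Measure Ω₂) [IsProbabilityMeasure P₂]
    (d : ℕ) (hd : 1 ≤ d)
    (Z : Ω → (Fin d → ℝ) → ℝ≥0) (hZ : IsSpectralField P Z)
    (V : ℕ → Ω₁ → ℝ) (W : ℕ → Ω₁ → (Fin d → ℝ) → ℝ≥0) (hVW : IsDeHaanSample P Z P₁ V W)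
    (hX : IsStationaryField P₁ (deHaanField V W))
    (R : Ω₂ → ℝ) (Θ : Ω₂ → (Fin d → ℝ) → ℝ≥0) (hRΘ : IsParetoTilted P Z P₂ R Θ)
    (δ : ℝ) (hδ : 0 ≤ δ) (x : ℝ) (hx : 0 < x) :
    Tendsto (fun T : ℝ => bermanPre P Z δ T x / ENNReal.ofReal (T ^ d)) atTop
        (𝓝 (bermanFun P Z δ x)) ∧
      P₂ {ω | ENNReal.ofReal x < sojournY δ R Θ ω} ^ 2 / ∫⁻ ω, sojournY δ R Θ ω ∂P₂
        ≤ bermanFun P Z δ x ∧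
      bermanFun P Z δ x
        ≤ (ENNReal.ofReal x)⁻¹ * P₂ {ω | ENNReal.ofReal x ≤ sojournY δ R Θ ω} := by
  have hlim := tendsto_bermanPre_div hZ hVW hX hδ hx
  have hval : bermanFun P Z δ x = bermanValue P Z δ x := hlim.limUnder_eq
  have hS := measurable_regSojourn (d := d) δ MeasurableSet.univ
  have hY : Measurable (fun ω => multPath (R ω, Θ ω)) :=
    measurable_multPath.comp (hRΘ.measurable_R.prodMk hRΘ.measurable_Θ)
  have hlaw := map_multPath_eq_exceedanceLaw hZ hRΘ
  have hae := hRΘ.sojournY_ae_eq δ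
  have hmeas : ∀ s : Set ℝ≥0∞, MeasurableSet s →
      P₂ {ω | sojournY δ R Θ ω ∈ s} = exceedanceLaw P Z {f | regSojourn δ Set.univ f ∈ s} := by
    intro s hs
    rw [← hlaw, Measure.map_apply (s := {f | regSojourn δ Set.univ f ∈ s}) hY (hS hs)]
    refine measure_congr ?_
    filter_upwards [hae] with ω hω
    refine propext ?_
    change sojournY δ R Θ ω ∈ s ↔ regSojourn δ Set.univ (multPath (R ω, Θ ω)) ∈ s
    rw [hω]
  have hmean : ∫⁻ ω, sojournY δ R Θ ω ∂P₂
      = ∫⁻ f, regSojourn δ Set.univ f ∂(exceedanceLaw P Z) := by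
    rw [← hlaw, lintegral_map hS hY]
    exact lintegral_congr_ae hae
  have hlt := hmeas (Set.Ioi (ENNReal.ofReal x)) measurableSet_Ioi
  have hge := hmeas (Set.Ici (ENNReal.ofReal x)) measurableSet_Ici
  simp only [Set.mem_Ioi, Set.mem_Ici] at hlt hge
  rw [hval]
  refine ⟨hlim, ?_, ?_⟩
  · rw [hlt, hmean]
    by_cases hfin : ∫⁻ f, regSojourn δ Set.univ f ∂(exceedanceLaw P Z) = ∞
    -- Division by ∞ gives 0 in `ℝ≥0∞`, which is the stated convention for an infinite mean.
    · rw [hfin, ENNReal.div_top]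
      exact zero_le
    · exact ENNReal.div_le_of_le_mul (sq_measure_lt_le hS hfin _)
  · rw [hge, bermanValue, ← lintegral_indicator_const
      (measurableSet_le measurable_const hS)]
    refine lintegral_mono fun f => ?_
    by_cases h : ENNReal.ofReal x < regSojourn δ Set.univ f
    · rw [Set.indicator_of_mem (show f ∈ {f | _ ≤ regSojourn δ Set.univ f} from h.le)]
      exact truncInv_le _ _
    · rw [truncInv, Set.indicator_of_notMem (by simpa using h)]
      exact zero_le
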